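/- All graphs are finite, undirected, without loops or parallel edges. A graph is claw-free if it has no induced subgraph isomorphic to $K_{1,3}$. For $k \ge 1$, a graph is $k$-connected if it has more than $k$ vertices and remains connected after the deletion of any set of fewer than $k$ vertices. A $\Lambda$-factor of a graph is a spanning subgraph each of whose connected components is a path on exactly three vertices. Let $v(G)$ denote the number of vertices of $G$. Let $G$ be a claw-free graph with $v(G) \equiv 1 \pmod 3$. (1) If $G$ is 2-connected, then for every vertex $x$ of $G$ the graph $G - x$ has a $\Lambda$-factor. (2) If $G$ is 3-connected, then for every vertex $x$ of $G$ and every edge $e$ of $G$ the graph $G - \{x, e\}$, obtained from $G$ by deleting the vertex $x$ (with all edges incident to it) and the edge $e$ (but not the end-vertices of $e$), has a $\Lambda$-factor. -/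

import Mathlib

/-- `G` is claw-free: no induced subgraph of `G` is isomorphic to `K_{1,3}`. -/
def ClawFree {V : Type*} (G : SimpleGraph V) : Prop :=
  ¬ (completeBipartiteGraph (Fin 1) (Fin 3)).IsIndContained G

/-- `G` is `k`-connected: it has more than `k` vertices, and deleting any set of
fewer than `k` vertices leaves a connected graph. -/
def IsVertexKConnected {V : Type*} [Fintype V] (G : SimpleGraph V) (k : ℕ) : Prop :=
  k < Fintype.card V ∧
    ∀ S : Finset V, S.card < k → (G.induce {v : V | v ∉ S}).Connected

/-- `P` is a `Λ`-factor of `G`: a spanning subgraph of `G` (same vertex set, edges among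
those of `G`) every component of which is a 3-vertex path. -/
def IsLambdaFactor {V : Type*} (G P : SimpleGraph V) : Prop :=
  P ≤ G ∧ ∀ C : P.ConnectedComponent,
    Nonempty (C.toSimpleGraph ≃g SimpleGraph.pathGraph 3)

/-- `G` has a `Λ`-factor. -/
def HasLambdaFactor {V : Type*} (G : SimpleGraph V) : Prop :=
  ∃ P : SimpleGraph V, IsLambdaFactor G P

/-- `G - x`: the graph obtained from `G` by deleting the vertex `x`. -/
def deleteVertex {V : Type*} (G : SimpleGraph V) (x : V) :
    SimpleGraph {v : V | v ≠ x} :=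
  G.induce {v : V | v ≠ x}

/-! Consider vertex sets S with two ends a ≠ b such that S induces a connected graph and every
nonempty part attached to the rest through a single vertex contains a or b: the blocks form a path
from a to b (`Chain`). The central result is `Chain.fac`: if 3 divides |S| and every claw in S has
both a and b among its leaves, then S splits into three-vertex paths.

The condition on claws is tailored to part (2): deleting an edge uv from a claw-free graph creates
only claws having u and v as leaves, and 3-connectedness makes G - {x, uv} a chain from u to v. If
the edge meets x, part (1) suffices. For part (1), 2-connectedness forces every part of G - x sealed
off by one vertex to contain a neighbour of x; as x is not the centre of a claw, suitable ends exist
(`exists_chain_ends`).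

`Chain.fac` goes by induction on |S|. Remove the end a. By `Chain.peel`, what remains is a chain
from a neighbour a' of a to b, or a `Branch`: at most two minimal fragments can exist without a claw
at a, and two of them yield disjoint sides D₁, D₂, both adjacent to a and hanging at c₁, c₂ on a
core that contains b. If three successive removals give chains, split off the path a a' a'' and
recurse. If a branch appears, the residues of |D₁| and |D₂| modulo 3 tell how to cut S into smaller
chains. The neighbourhoods where the cuts are made are cliques, because there are no claws, and a
clique of terminals can be shrunk to one vertex (`FacBelow.clique`). -/

namespace LambdaFactor

set_option linter.unusedSectionVars false

variable {V : Type*} [DecidableEq V] {G : SimpleGraph V}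

/-! ### Fragments and chains -/

/-- `D` is sealed off in `S` by the vertex `c`: all neighbours of `D` in `S` lie in `D ∪ {c}`. -/
def Sealed (G : SimpleGraph V) (S D : Finset V) (c : V) : Prop :=
  c ∈ S ∧ c ∉ D ∧ ∀ x ∈ D, ∀ y ∈ S, G.Adj x y → y ∈ D ∨ y = c

/-- `S` induces a connected subgraph, phrased through cuts. -/
def Conn (G : SimpleGraph V) (S : Finset V) : Prop :=
  S.Nonempty ∧ ∀ D ⊆ S, D.Nonempty → (∀ x ∈ D, ∀ y ∈ S, G.Adj x y → y ∈ D) → D = S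

/-- A nonempty part of `S` that avoids `B` and is sealed off by a single vertex. -/
def Frag (G : SimpleGraph V) (S : Finset V) (B : Set V) (D : Finset V) : Prop :=
  D ⊆ S ∧ D.Nonempty ∧ (∀ x ∈ D, x ∉ B) ∧ ∃ c, Sealed G S D c

/-- `S` is connected and every part of `S` sealed off by a vertex meets `A` or `B`. -/
structure Chain (G : SimpleGraph V) (S : Finset V) (A B : Set V) : Prop where
  conn : Conn G S
  left : ∃ x ∈ S, x ∈ A
  right : ∃ x ∈ S, x ∈ B
  meets : ∀ D, Frag G S B D → ∃ x ∈ D, x ∈ A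

theorem Chain.symm {S : Finset V} {A B : Set V} (h : Chain G S A B) : Chain G S B A where
  conn := h.conn
  left := h.right
  right := h.left
  meets D hD := by
    by_contra hB
    push Not at hB
    obtain ⟨x, hx, hxA⟩ := h.meets D ⟨hD.1, hD.2.1, hB, hD.2.2.2⟩
    exact hD.2.2.1 x hx hxA

theorem Chain.mono_left {S : Finset V} {A A' B : Set V} (h : Chain G S A B)
    (hA : ∀ x ∈ S, x ∈ A → x ∈ A') : Chain G S A' B where
  conn := h.conn
  left := by obtain ⟨x, hx, hxA⟩ := h.left; exact ⟨x, hx, hA x hx hxA⟩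
  right := h.right
  meets D hD := by obtain ⟨x, hx, hxA⟩ := h.meets D hD; exact ⟨x, hx, hA x (hD.1 hx) hxA⟩

/-- Two disjoint or crossing fragments cannot seal off each other. -/
theorem not_mutually_sealed {S D D' : Finset V} {B : Set V} {c c' : V} (hS : Conn G S)
    (hB : ∃ x ∈ S, x ∈ B) (hD : Frag G S B D) (hD' : Frag G S B D') (hc : Sealed G S D c)
    (hc' : Sealed G S D' c') : ¬ (c ∈ D' ∧ c' ∈ D) := by
  rintro ⟨h1, h2⟩
  -- The union has no neighbours outside itself, so it is all of S, although neither fragment meets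
  -- B.
  have := hS.2 (D ∪ D') (Finset.union_subset hD.1 hD'.1) (hD.2.1.mono Finset.subset_union_left) (by
    intro x hx y hy hxy
    have := hc.2.2 x
    have := hc'.2.2 x
    grind)
  obtain ⟨x, hx, hxB⟩ := hB
  rw [← this, Finset.mem_union] at hx
  rcases hx with hx | hx
  · exact hD.2.2.1 x hx hxB
  · exact hD'.2.2.1 x hx hxB

/-- If c lies in D', then c' is outside D and c seals the intersection; otherwise c' does. -/
theorem Sealed.inter {S D D' : Finset V} {c c' : V} (hc : Sealed G S D c) (hc' : Sealed G S D' c')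
    (hn : ¬ (c ∈ D' ∧ c' ∈ D)) : ∃ c, Sealed G S (D ∩ D') c := by
  have h1 := hc.2.2
  have h2 := hc'.2.2
  by_cases h : c ∈ D'
  · exact ⟨c, hc.1, by grind [hc.2.1], fun x hx y hy hxy => by grind⟩
  · exact ⟨c', hc'.1, by grind [hc'.2.1], fun x hx y hy hxy => by grind⟩

theorem Frag.inter {S D D' : Finset V} {B : Set V} (hS : Conn G S)
    (hB : ∃ x ∈ S, x ∈ B) (hD : Frag G S B D) (hD' : Frag G S B D') (hne : (D ∩ D').Nonempty) :
    Frag G S B (D ∩ D') := by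
  obtain ⟨c, hc⟩ := hD.2.2.2
  obtain ⟨c', hc'⟩ := hD'.2.2.2
  exact ⟨Finset.inter_subset_left.trans hD.1, hne, fun x hx => hD.2.2.1 x (by grind),
    hc.inter hc' (not_mutually_sealed hS hB hD hD' hc hc')⟩

/-- An edge between disjoint fragments would force each end to be the sealing vertex of the other
fragment. -/
theorem Frag.not_adj {S D D' : Finset V} {B : Set V} (hS : Conn G S)
    (hB : ∃ x ∈ S, x ∈ B) (hD : Frag G S B D) (hD' : Frag G S B D') (hdisj : ¬ (D ∩ D').Nonempty)
    {x y : V} (hx : x ∈ D) (hy : y ∈ D') : ¬ G.Adj x y := by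
  intro hxy
  obtain ⟨c, hc⟩ := hD.2.2.2
  obtain ⟨c', hc'⟩ := hD'.2.2.2
  have hn := not_mutually_sealed hS hB hD hD' hc hc'
  have h1 := hc.2.2 x hx y (hD'.1 hy) hxy
  have h2 := hc'.2.2 y hy x (hD.1 hx) hxy.symm
  have : ∀ z, z ∈ D → z ∉ D' := fun z hz hz' => hdisj ⟨z, by grind⟩
  grind

/-- A minimal fragment. -/
def MinFrag (G : SimpleGraph V) (S : Finset V) (B : Set V) (M : Finset V) : Prop :=
  Frag G S B M ∧ ∀ D, Frag G S B D → D ⊆ M → D = M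

theorem Frag.exists_minFrag {S : Finset V} {B : Set V} {D : Finset V} (hD : Frag G S B D) :
    ∃ M, MinFrag G S B M ∧ M ⊆ D := by
  induction D using Finset.strongInduction with
  | H D ih =>
    by_cases h : ∀ D', Frag G S B D' → D' ⊆ D → D' = D
    · exact ⟨D, ⟨hD, h⟩, subset_rfl⟩
    · push Not at h
      obtain ⟨D', h1, h2, h3⟩ := h
      obtain ⟨M, hM, hM'⟩ := ih D' (Finset.ssubset_iff_subset_ne.2 ⟨h2, h3⟩) h1
      exact ⟨M, hM, hM'.trans h2⟩

theorem MinFrag.subset {S : Finset V} {B : Set V} {M D : Finset V} (hS : Conn G S)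
    (hB : ∃ x ∈ S, x ∈ B) (hM : MinFrag G S B M) (hD : Frag G S B D) (h : (M ∩ D).Nonempty) :
    M ⊆ D := by
  have := hM.2 _ (hM.1.inter hS hB hD h) Finset.inter_subset_left
  rw [← this]
  exact Finset.inter_subset_right

/-- If all fragments contain a common fragment, they share a terminal. -/
theorem exists_chain_singleton {S : Finset V} {A B : Set V} (hS : Conn G S)
    (hB : ∃ x ∈ S, x ∈ B) (hmeet : ∀ D, Frag G S B D → ∃ x ∈ D, x ∈ A)
    (hpair : ∀ M M', MinFrag G S B M → MinFrag G S B M' → M = M') {z : V} (hz : z ∈ B)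
    (hA : ∃ a ∈ S, a ∈ A ∧ a ≠ z) : ∃ a ∈ S, a ∈ A ∧ a ≠ z ∧ Chain G S {a} B := by
  by_cases h : ∃ D, Frag G S B D
  · obtain ⟨D, hD⟩ := h
    obtain ⟨M, hM, -⟩ := hD.exists_minFrag
    obtain ⟨a, haM, haA⟩ := hmeet M hM.1
    have haS := hM.1.1 haM
    refine ⟨a, haS, haA, ?_, hS, ⟨a, haS, rfl⟩, hB, ?_⟩
    · rintro rfl; exact hM.1.2.2.1 _ haM hz
    · intro D' hD'
      obtain ⟨M', hM', hMD⟩ := hD'.exists_minFrag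
      have := hpair M M' hM hM'
      subst this
      exact ⟨a, hMD haM, rfl⟩
  · obtain ⟨a, haS, haA, haz⟩ := hA
    exact ⟨a, haS, haA, haz, hS, ⟨a, haS, rfl⟩, hB, fun D hD => (h ⟨D, hD⟩).elim⟩

/-- A clique of terminals can be replaced by a single vertex. -/
theorem Chain.exists_singleton {S : Finset V} {A B : Set V} (h : Chain G S A B)
    (hA : ∀ x ∈ S, ∀ y ∈ S, x ∈ A → y ∈ A → x ≠ y → G.Adj x y) (hcard : 2 ≤ S.card) {z : V}
    (hz : z ∈ B) : ∃ a ∈ S, a ≠ z ∧ Chain G S {a} B := by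
  by_cases hex : ∃ a ∈ S, a ∈ A ∧ a ≠ z
  · obtain ⟨a, h1, -, h2⟩ := exists_chain_singleton h.conn h.right h.meets (by
      intro M M' hM hM'
      by_cases hne : (M ∩ M').Nonempty
      · have h1 := hM.subset h.conn h.right hM'.1 hne
        have h2 := hM'.subset h.conn h.right hM.1 (by rwa [Finset.inter_comm])
        exact h1.antisymm h2
      · obtain ⟨x, hx, hxA⟩ := h.meets M hM.1
        obtain ⟨y, hy, hyA⟩ := h.meets M' hM'.1
        refine (hM.1.not_adj h.conn h.right hM'.1 hne hx hy ?_).elim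
        refine hA x (hM.1.1 hx) y (hM'.1.1 hy) hxA hyA ?_
        rintro rfl
        exact hne ⟨x, by grind⟩) hz hex
    exact ⟨a, h1, h2⟩
  · push Not at hex
    obtain ⟨a, haS, haz⟩ := Finset.exists_mem_ne (by omega : 1 < S.card) z
    refine ⟨a, haS, haz, h.conn, ⟨a, haS, rfl⟩, h.right, fun D hD => ?_⟩
    obtain ⟨x, hx, hxA⟩ := h.meets D hD
    have := hex x (hD.1 hx) hxA
    exact (hD.2.2.1 x hx (this ▸ hz)).elim

/-- A fragment avoiding o is not sealed by o, as it would then be all of S. So it is sealed by a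
vertex of S, hence meets A, and the edge from there to o leaves it. -/
theorem Chain.insert {S : Finset V} {A B : Set V} (h : Chain G S A B) {o : V} (ho : o ∉ S)
    (hA : ∀ x ∈ S, x ∈ A → G.Adj o x) : Chain G (insert o S) {o} B where
  conn := by
    refine ⟨⟨o, by simp⟩, fun D hD hne hcl => ?_⟩
    obtain ⟨p, hp, hpA⟩ := h.left
    have hop := hA p hp hpA
    have key : (D ∩ S).Nonempty → D ∩ S = S := fun hne' =>
      h.conn.2 _ Finset.inter_subset_right hne' (by
        intro x hx y hy hxy
        have := hcl x (by grind) y (by grind) hxy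
        grind)
    have hDS : (D ∩ S).Nonempty := by
      obtain ⟨x, hx⟩ := hne
      by_cases hxo : x = o
      · subst hxo
        exact ⟨p, by have := hcl x hx p (by grind) hop; grind⟩
      · exact ⟨x, by grind⟩
    have hk := key hDS
    have hpD : p ∈ D := by rw [← hk] at hp; grind
    have hoD := hcl p hpD o (by grind) hop.symm
    apply hD.antisymm
    intro x hx
    rcases Finset.mem_insert.1 hx with rfl | hx
    · exact hoD
    · rw [← hk] at hx; grind
  left := ⟨o, by simp, rfl⟩
  right := by obtain ⟨x, hx, hxB⟩ := h.right; exact ⟨x, by grind, hxB⟩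
  meets D hD := by
    by_contra hoD
    have hoD : o ∉ D := fun h => hoD ⟨o, h, rfl⟩
    obtain ⟨hDS, hne, hDB, c, hc, hcD, hcl⟩ := hD
    have hDS' : D ⊆ S := fun x hx => by
      rcases Finset.mem_insert.1 (hDS hx) with rfl | h
      · exact (hoD hx).elim
      · exact h
    rcases Finset.mem_insert.1 hc with rfl | hcS
    · have := h.conn.2 D hDS' hne (by
        intro x hx y hy hxy
        rcases hcl x hx y (by grind) hxy with h | rfl
        · exact h
        · exact (ho hy).elim)
      obtain ⟨x, hx, hxB⟩ := h.right
      exact hDB x (this ▸ hx) hxB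
    · obtain ⟨x, hx, hxA⟩ := h.meets D ⟨hDS', hne, hDB, c, hcS, hcD,
        fun x hx y hy hxy => hcl x hx y (by grind) hxy⟩
      rcases hcl x hx o (by grind) (hA x (hDS' hx) hxA).symm with h | rfl
      · exact hoD h
      · exact ho hcS

/-- Concatenation of chains across the vertex o. A fragment with its sealing vertex in one of the
two chains cannot touch the other one, since that one is connected and would be swallowed with its
terminal; the edges at o then lead out of the fragment. -/
theorem Chain.glue {X Y : Finset V} {B₁ B₂ : Set V} {o : V} (hX : Chain G X {o} B₁)
    (hY : Chain G Y (G.neighborSet o) B₂) (hdisj : ∀ x ∈ X, x ∉ Y) : Chain G (X ∪ Y) B₁ B₂ := by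
  have hoX : o ∈ X := by obtain ⟨x, hx, rfl⟩ := hX.left; exact hx
  obtain ⟨p, hp, hop⟩ := hY.left
  rw [SimpleGraph.mem_neighborSet] at hop
  obtain ⟨b₁, hb₁, hb₁'⟩ := hX.right
  obtain ⟨b₂, hb₂, hb₂'⟩ := hY.right
  have keyX : ∀ D, (D ∩ X).Nonempty → (∀ x ∈ D, ∀ y ∈ X, G.Adj x y → y ∈ D) → X ⊆ D := by
    intro D hne hcl
    have := hX.conn.2 (D ∩ X) Finset.inter_subset_right hne (by
      intro x hx y hy hxy
      have := hcl x (by grind) y (by grind) hxy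
      grind)
    rw [← this]; exact Finset.inter_subset_left
  have keyY : ∀ D, (D ∩ Y).Nonempty → (∀ x ∈ D, ∀ y ∈ Y, G.Adj x y → y ∈ D) → Y ⊆ D := by
    intro D hne hcl
    have := hY.conn.2 (D ∩ Y) Finset.inter_subset_right hne (by
      intro x hx y hy hxy
      have := hcl x (by grind) y (by grind) hxy
      grind)
    rw [← this]; exact Finset.inter_subset_left
  refine ⟨⟨⟨o, by grind⟩, fun D hD hne hcl => ?_⟩, ⟨b₁, by grind, hb₁'⟩, ⟨b₂, by grind, hb₂'⟩, ?_⟩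
  · have hx := fun h => keyX D h (fun x hx y hy hxy => hcl x hx y (by grind) hxy)
    have hy := fun h => keyY D h (fun x hx y hy hxy => hcl x hx y (by grind) hxy)
    have h1 : o ∈ D → p ∈ D := fun h => hcl o h p (by grind) hop
    have h2 : p ∈ D → o ∈ D := fun h => hcl p h o (by grind) hop.symm
    obtain ⟨q, hq⟩ := hne
    have hoD : o ∈ D := by
      rcases Finset.mem_union.1 (hD hq) with h | h
      · exact hx ⟨q, by grind⟩ hoX
      · exact h2 (hy ⟨q, by grind⟩ hp)
    have hX' := hx ⟨o, by grind⟩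
    have hY' := hy ⟨p, by grind⟩
    exact hD.antisymm (Finset.union_subset hX' hY')
  · rintro D ⟨hDS, hne, hDB, c, hc, hcD, hcl⟩
    by_contra hcon
    push Not at hcon
    rcases Finset.mem_union.1 hc with hcX | hcY
    · have hDY : ∀ x ∈ D, x ∉ Y := by
        intro x hx hxY
        refine hDB b₂ (keyY D ⟨x, by grind⟩ ?_ hb₂) hb₂'
        intro x hx y hy hxy
        rcases hcl x hx y (by grind) hxy with h | rfl
        · exact h
        · exact (hdisj _ hcX hy).elim
      obtain ⟨x, hx, rfl⟩ := hX.meets D ⟨fun x hx => by grind, hne, hcon, c, hcX, hcD,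
        fun x hx y hy hxy => hcl x hx y (by grind) hxy⟩
      rcases hcl x hx p (by grind) hop with h | rfl
      · exact hDY _ h hp
      · exact hdisj _ hcX hp
    · have hDX : ∀ x ∈ D, x ∉ X := by
        intro x hx hxY
        refine hcon b₁ (keyX D ⟨x, by grind⟩ ?_ hb₁) hb₁'
        intro x hx y hy hxy
        rcases hcl x hx y (by grind) hxy with h | rfl
        · exact h
        · exact (hdisj _ hy hcY).elim
      obtain ⟨x, hx, hxo⟩ := hY.meets D ⟨fun x hx => by grind, hne, hDB, c, hcY, hcD,
        fun x hx y hy hxy => hcl x hx y (by grind) hxy⟩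
      rw [SimpleGraph.mem_neighborSet] at hxo
      rcases hcl x hx o (by grind) hxo.symm with h | rfl
      · exact hDX _ h hoX
      · exact hdisj _ hoX hcY

/-! ### Branches: what two distinct minimal fragments look like -/

/-- `w` is not the centre of a claw with leaves in `S`. -/
def NoClawAt (G : SimpleGraph V) (S : Finset V) (w : V) : Prop :=
  ∀ x ∈ S, ∀ y ∈ S, ∀ z ∈ S, G.Adj w x → G.Adj w y → G.Adj w z → x ≠ y → x ≠ z → y ≠ z →
    G.Adj x y ∨ G.Adj x z ∨ G.Adj y z

theorem NoClawAt.mono {S T : Finset V} {w : V} (h : NoClawAt G T w) (hST : S ⊆ T) :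
    NoClawAt G S w := fun x hx y hy z hz => h x (hST hx) y (hST hy) z (hST hz)

/-- Two disjoint parts `D₁`, `D₂` of `T`, each adjacent to the outside vertex `o` and attached to
the rest of `T` (which contains `b`) at `c₁` and `c₂`. -/
structure Branch (G : SimpleGraph V) (T : Finset V) (o b : V) (D₁ D₂ : Finset V) (c₁ c₂ : V) :
    Prop where
  sub₁ : D₁ ⊆ T
  sub₂ : D₂ ⊆ T
  disj : ∀ x ∈ D₁, x ∉ D₂
  b_mem : b ∈ T
  b₁ : b ∉ D₁
  b₂ : b ∉ D₂
  c₁_mem : c₁ ∈ T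
  c₁₁ : c₁ ∉ D₁
  c₁₂ : c₁ ∉ D₂
  c₂_mem : c₂ ∈ T
  c₂₁ : c₂ ∉ D₁
  c₂₂ : c₂ ∉ D₂
  sealed₁ : ∀ x ∈ D₁, ∀ y ∈ T, G.Adj x y → y ∈ D₁ ∨ y = c₁
  sealed₂ : ∀ x ∈ D₂, ∀ y ∈ T, G.Adj x y → y ∈ D₂ ∨ y = c₂
  chain₁ : Chain G D₁ (G.neighborSet o) (G.neighborSet c₁)
  chain₂ : Chain G D₂ (G.neighborSet o) (G.neighborSet c₂)
  core₁ : Chain G (T \ (D₁ ∪ D₂)) {c₁} {b}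
  core₂ : Chain G (T \ (D₁ ∪ D₂)) {c₂} {b}
  rest₂ : Chain G (T \ D₁) (G.neighborSet o ∩ ↑D₂) {b}
  rest₁ : Chain G (T \ D₂) (G.neighborSet o ∩ ↑D₁) {b}

theorem Branch.swap {T : Finset V} {o b : V} {D₁ D₂ : Finset V} {c₁ c₂ : V}
    (h : Branch G T o b D₁ D₂ c₁ c₂) : Branch G T o b D₂ D₁ c₂ c₁ where
  sub₁ := h.sub₂
  sub₂ := h.sub₁
  disj := fun x hx hx' => h.disj x hx' hx
  b_mem := h.b_mem
  b₁ := h.b₂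
  b₂ := h.b₁
  c₁_mem := h.c₂_mem
  c₁₁ := h.c₂₂
  c₁₂ := h.c₂₁
  c₂_mem := h.c₁_mem
  c₂₁ := h.c₁₂
  c₂₂ := h.c₁₁
  sealed₁ := h.sealed₂
  sealed₂ := h.sealed₁
  chain₁ := h.chain₂
  chain₂ := h.chain₁
  core₁ := by rw [Finset.union_comm]; exact h.core₂
  core₂ := by rw [Finset.union_comm]; exact h.core₁
  rest₂ := h.rest₁
  rest₁ := h.rest₂

/-- A largest fragment containing `M` and disjoint from `M'`. -/
theorem exists_maxFrag {S : Finset V} {B : Set V} {M M' : Finset V} (hM : Frag G S B M)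
    (hdisj : ¬ (M ∩ M').Nonempty) :
    ∃ D, Frag G S B D ∧ M ⊆ D ∧ ¬ (D ∩ M').Nonempty ∧
      ∀ E, Frag G S B E → D ⊆ E → ¬ (E ∩ M').Nonempty → E = D := by
  classical
  have hne : (S.powerset.filter fun D => Frag G S B D ∧ M ⊆ D ∧ ¬ (D ∩ M').Nonempty).Nonempty :=
    ⟨M, by simp only [Finset.mem_filter, Finset.mem_powerset]; exact ⟨hM.1, hM, subset_rfl, hdisj⟩⟩
  obtain ⟨D, hD, hmax⟩ := Finset.exists_max_image _ Finset.card hne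
  simp only [Finset.mem_filter, Finset.mem_powerset] at hD hmax
  refine ⟨D, hD.2.1, hD.2.2.1, hD.2.2.2, fun E hE hDE hEM => ?_⟩
  exact (Finset.eq_of_subset_of_card_le hDE (hmax E ⟨hE.1, hE, hD.2.2.1.trans hDE, hEM⟩)).symm

/-- The data on one of the two sides, given two minimal fragments. -/
theorem Conn.side {T : Finset V} {o b : V} (hT : Conn G T) (hb : b ∈ T)
    {M₁ M₂ D₁ : Finset V} {c₁ : V}
    (hmeet : ∀ D, Frag G T {b} D → ∃ x ∈ D, x ∈ G.neighborSet o)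
    (hall : ∀ D, Frag G T {b} D → M₁ ⊆ D ∨ M₂ ⊆ D)
    (hM₁ : MinFrag G T {b} M₁) (hM₂ : MinFrag G T {b} M₂)
    (hD₁ : Frag G T {b} D₁) (hdisj : ¬ (D₁ ∩ M₂).Nonempty)
    (hc₁ : Sealed G T D₁ c₁) :
    Chain G D₁ (G.neighborSet o) (G.neighborSet c₁) := by
  have hbT : ∃ x ∈ T, x ∈ ({b} : Set V) := ⟨b, hb, rfl⟩
  have hsub : ∀ D, Frag G T {b} D → D ⊆ D₁ → M₁ ⊆ D := by
    intro D hD hDD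
    rcases hall D hD with h | h
    · exact h
    · obtain ⟨x, hx⟩ := hM₂.1.2.1
      exact (hdisj ⟨x, by grind⟩).elim
  have hbD : ∀ x ∈ D₁, x ≠ b := fun x hx => hD₁.2.2.1 x hx
  obtain ⟨q, hq⟩ := hM₁.1.2.1
  refine ⟨⟨hD₁.2.1, fun D hD hne hcl => ?_⟩, ?_, ?_, ?_⟩
  -- A closed part of D₁ and its complement in D₁ would both be fragments of T, hence both contain
  -- M₁.
  · by_contra hneq
    have hf : Frag G T {b} D := ⟨hD.trans hD₁.1, hne, fun x hx => hbD x (hD hx), c₁, hc₁.1,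
      fun h => hc₁.2.1 (hD h), fun x hx y hy hxy => by
        rcases hc₁.2.2 x (hD hx) y hy hxy with h | h
        · exact Or.inl (hcl x hx y h hxy)
        · exact Or.inr h⟩
    have hne' : (D₁ \ D).Nonempty := by
      rw [Finset.sdiff_nonempty]
      intro h
      exact hneq (hD.antisymm h)
    have hf' : Frag G T {b} (D₁ \ D) := ⟨Finset.sdiff_subset.trans hD₁.1, hne',
      fun x hx => hbD x (by grind), c₁, hc₁.1, fun h => hc₁.2.1 (by grind),
      fun x hx y hy hxy => by
        rcases hc₁.2.2 x (by grind) y hy hxy with h | h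
        · left
          have : y ∉ D := fun hyD => by
            have := hcl y hyD x (by grind) hxy.symm
            grind
          grind
        · exact Or.inr h⟩
    have h1 := hsub _ hf hD hq
    have h2 := hsub _ hf' Finset.sdiff_subset hq
    grind
  · obtain ⟨x, hx, hxA⟩ := hmeet D₁ hD₁
    exact ⟨x, hx, hxA⟩
  · by_contra hcon
    push Not at hcon
    have := hT.2 D₁ hD₁.1 hD₁.2.1 (fun x hx y hy hxy => by
      rcases hc₁.2.2 x hx y hy hxy with h | rfl
      · exact h
      · exact (hcon x hx hxy.symm).elim)
    exact hc₁.2.1 (this ▸ hc₁.1)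
  · rintro D ⟨hDD, hne, hDc, c, hc, hcD, hcl⟩
    have hf : Frag G T {b} D := ⟨hDD.trans hD₁.1, hne, fun x hx => hbD x (hDD hx), c,
      hD₁.1 hc, hcD, fun x hx y hy hxy => by
        rcases hc₁.2.2 x (hDD hx) y hy hxy with h | rfl
        · exact hcl x hx y h hxy
        · exact (hDc x hx hxy.symm).elim⟩
    exact hmeet D hf

/-- A fragment of T \ D₂ becomes a fragment of T once D₂ is added whenever c₂ belongs to it. By
maximality of D₂, the enlarged fragment contains M₁, and with it a neighbour of o in D₁. -/
theorem Conn.rest {T : Finset V} {o b : V} (hT : Conn G T) (hb : b ∈ T)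
    {M₁ M₂ D₁ D₂ : Finset V} {c₂ : V}
    (hmeet : ∀ D, Frag G T {b} D → ∃ x ∈ D, x ∈ G.neighborSet o)
    (hall : ∀ D, Frag G T {b} D → M₁ ⊆ D ∨ M₂ ⊆ D)
    (hM₁ : MinFrag G T {b} M₁) (hM₂ : MinFrag G T {b} M₂)
    (hM₁D : M₁ ⊆ D₁) (hM₂D : M₂ ⊆ D₂)
    (hD₂ : Frag G T {b} D₂) (hdisj : ∀ x ∈ D₁, x ∉ D₂)
    (hmax₂ : ∀ E, Frag G T {b} E → D₂ ⊆ E → ¬ (E ∩ M₁).Nonempty → E = D₂)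
    (hc₂ : Sealed G T D₂ c₂) :
    Chain G (T \ D₂) (G.neighborSet o ∩ ↑D₁) {b} := by
  have hbT : ∃ x ∈ T, x ∈ ({b} : Set V) := ⟨b, hb, rfl⟩
  have hbD : ∀ x ∈ D₂, x ≠ b := fun x hx => hD₂.2.2.1 x hx
  obtain ⟨p, hp, hpo⟩ := hmeet M₁ hM₁.1
  refine ⟨⟨⟨b, ?_⟩, fun D hD hne hcl => ?_⟩, ⟨p, ?_, hpo, hM₁D hp⟩, ⟨b, ?_, rfl⟩, ?_⟩
  · grind
  · by_cases h : c₂ ∈ D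
    · have := hT.2 (D ∪ D₂) (Finset.union_subset (hD.trans Finset.sdiff_subset) hD₂.1)
        (hne.mono Finset.subset_union_left) (fun x hx y hy hxy => by
          have := hc₂.2.2 x
          have := hcl x
          grind)
      rw [← this]
      grind
    · have := hT.2 D (hD.trans Finset.sdiff_subset) hne (fun x hx y hy hxy => by
          by_cases hy2 : y ∈ D₂
          · have := hc₂.2.2 y hy2 x
            have := hxy.symm
            grind
          · exact hcl x hx y (by grind) hxy)
      exact (h (this ▸ hc₂.1)).elim
  · have := hM₁.1.1 hp
    have := hdisj p (hM₁D hp)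
    grind
  · grind
  · rintro D ⟨hDD, hne, hDb, c, hc, hcD, hcl⟩
    have hDb' : b ∉ D := fun h => hDb b h rfl
    by_cases h : c₂ ∈ D
    · have hf : Frag G T {b} (D ∪ D₂) := ⟨Finset.union_subset (hDD.trans Finset.sdiff_subset) hD₂.1,
        hne.mono Finset.subset_union_left, (fun x hx => by
          have := hbD x
          simp only [Set.mem_singleton_iff]
          rintro rfl
          grind), c, by grind, by grind, fun x hx y hy hxy => by
          have := hc₂.2.2 x
          have := hcl x
          grind⟩
      by_cases hM : ((D ∪ D₂) ∩ M₁).Nonempty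
      · have := hM₁.subset hT hbT hf (by rwa [Finset.inter_comm])
        have hpD := this hp
        refine ⟨p, ?_, hpo, hM₁D hp⟩
        have := hdisj p (hM₁D hp)
        grind
      · have := hmax₂ _ hf Finset.subset_union_right hM
        obtain ⟨x, hx⟩ := hne
        have h1 : x ∈ D₂ := by rw [← this]; grind
        grind
    · have hf : Frag G T {b} D := ⟨(hDD.trans Finset.sdiff_subset),
        hne, hDb, c, by grind, by grind, fun x hx y hy hxy => by
          by_cases hy2 : y ∈ D₂
          · have := hc₂.2.2 y hy2 x
            have := hxy.symm
            grind
          · exact hcl x hx y (by grind) hxy⟩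
      rcases hall D hf with h' | h'
      · exact ⟨p, h' hp, hpo, hM₁D hp⟩
      · obtain ⟨x, hx⟩ := hM₂.1.2.1
        have := hM₂D hx
        have := h' hx
        grind

/-- Fragments of the core are lifted to T by adding each Dᵢ whose attachment vertex they contain. A
lifted fragment without c₁ must contain M₂, hence D₂, and then equals D₂ by maximality, leaving
nothing in the core. -/
theorem Conn.core {T : Finset V} {b : V} (hT : Conn G T) (hb : b ∈ T)
    {M₁ M₂ D₁ D₂ : Finset V} {c₁ c₂ : V}
    (hall : ∀ D, Frag G T {b} D → M₁ ⊆ D ∨ M₂ ⊆ D)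
    (hM₁ : MinFrag G T {b} M₁) (hM₂ : MinFrag G T {b} M₂)
    (hM₁D : M₁ ⊆ D₁) (hM₂D : M₂ ⊆ D₂)
    (hD₁ : Frag G T {b} D₁)
    (hD₂ : Frag G T {b} D₂) (hdisj : ∀ x ∈ D₁, x ∉ D₂)
    (hmax₂ : ∀ E, Frag G T {b} E → D₂ ⊆ E → ¬ (E ∩ M₁).Nonempty → E = D₂)
    (hc₁ : Sealed G T D₁ c₁) (hc₂ : Sealed G T D₂ c₂) (hc₁₂ : c₁ ∉ D₂) (hc₂₁ : c₂ ∉ D₁) :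
    Chain G (T \ (D₁ ∪ D₂)) {c₁} {b} := by
  have hbD₁ : ∀ x ∈ D₁, x ≠ b := fun x hx => hD₁.2.2.1 x hx
  have hbD₂ : ∀ x ∈ D₂, x ≠ b := fun x hx => hD₂.2.2.1 x hx
  have s1 := hc₁.2.2
  have s2 := hc₂.2.2
  have m1 := hc₁.1
  have m2 := hc₂.1
  have n1 := hc₁.2.1
  have n2 := hc₂.2.1
  have hsub1 := hD₁.1
  have hsub2 := hD₂.1
  -- the saturation of a part of the core
  have key : ∀ D ⊆ T \ (D₁ ∪ D₂), ∃ E, D ⊆ E ∧ E ⊆ T ∧ E \ (D₁ ∪ D₂) = D ∧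
      (∀ x ∈ D₁, x ∈ E ↔ c₁ ∈ D) ∧ (∀ x ∈ D₂, x ∈ E ↔ c₂ ∈ D) := by
    intro D hD
    refine ⟨D ∪ (if c₁ ∈ D then D₁ else ∅) ∪ (if c₂ ∈ D then D₂ else ∅), ?_, ?_, ?_, ?_, ?_⟩
    · grind
    · grind
    · ext x; grind
    · grind
    · grind
  have hcls : ∀ D E : Finset V, D ⊆ E → E ⊆ T → E \ (D₁ ∪ D₂) = D →
      (∀ x ∈ D₁, x ∈ E ↔ c₁ ∈ D) → (∀ x ∈ D₂, x ∈ E ↔ c₂ ∈ D) →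
      ∀ P : V → Prop,
      (∀ x ∈ D, ∀ y ∈ T \ (D₁ ∪ D₂), G.Adj x y → y ∈ D ∨ P y) →
      ∀ x ∈ E, ∀ y ∈ T, G.Adj x y → y ∈ E ∨ P y := by
    intro D E h1 h0 h2 h3 h4 P hcl x hx y hy hxy
    have e1 : ∀ x, x ∈ D ↔ x ∈ E ∧ x ∉ D₁ ∧ x ∉ D₂ := by intro x; rw [← h2]; grind
    have := hxy.symm
    by_cases hx1 : x ∈ D₁
    · have := s1 x hx1 y hy hxy
      grind
    by_cases hx2 : x ∈ D₂
    · have := s2 x hx2 y hy hxy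
      grind
    by_cases hy1 : y ∈ D₁
    · have := s1 y hy1 x
      grind
    by_cases hy2 : y ∈ D₂
    · have := s2 y hy2 x
      grind
    have := hcl x (by grind) y (by grind) hxy
    grind
  refine ⟨⟨⟨b, by grind⟩, fun D hD hne hcl => ?_⟩, ⟨c₁, by grind, rfl⟩, ⟨b, by grind, rfl⟩, ?_⟩
  · obtain ⟨E, h1, h2, h3, h4, h5⟩ := key D hD
    have := hT.2 E h2 (hne.mono h1) (fun x hx y hy hxy => by
      simpa using hcls D E h1 h2 h3 h4 h5 (fun _ => False) (by simpa using hcl) x hx y hy hxy)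
    rw [← h3, this]
  · rintro D ⟨hDD, hne, hDb, c, hc, hcD, hcl⟩
    refine ⟨c₁, ?_, rfl⟩
    have hDb' : b ∉ D := fun h => hDb b h rfl
    obtain ⟨E, h1, h2, h3, h4, h5⟩ := key D hDD
    have e1 : ∀ x, x ∈ D ↔ x ∈ E ∧ x ∉ D₁ ∧ x ∉ D₂ := by intro x; rw [← h3]; grind
    have hf : Frag G T {b} E := ⟨h2, hne.mono h1, by
        intro x hx
        have := hbD₁ x
        have := hbD₂ x
        simp only [Set.mem_singleton_iff]
        rintro rfl
        grind, c, by grind, by grind, hcls D E h1 h2 h3 h4 h5 (fun y => y = c) hcl⟩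
    by_contra hc1D
    rcases hall E hf with h | h
    · obtain ⟨x, hx⟩ := hM₁.1.2.1
      exact hc1D ((h4 x (hM₁D hx)).1 (h hx))
    · obtain ⟨x, hx⟩ := hM₂.1.2.1
      have hc2 : c₂ ∈ D := (h5 x (hM₂D hx)).1 (h hx)
      have := hmax₂ E hf (fun y hy => (h5 y hy).2 hc2) (by
        rintro ⟨y, hy⟩
        exact hc1D ((h4 y (hM₁D (by grind))).1 (by grind)))
      obtain ⟨z, hz⟩ := hne
      grind

/-- Two different minimal fragments give rise to a branch. -/
theorem exists_branch {T : Finset V} {o b : V} (hT : Conn G T) (hb : b ∈ T)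
    (hmeet : ∀ D, Frag G T {b} D → ∃ x ∈ D, x ∈ G.neighborSet o)
    (hclaw : NoClawAt G T o) {M₁ M₂ : Finset V} (hM₁ : MinFrag G T {b} M₁)
    (hM₂ : MinFrag G T {b} M₂) (hne : M₁ ≠ M₂) :
    ∃ D₁ D₂ c₁ c₂, Branch G T o b D₁ D₂ c₁ c₂ := by
  have hbT : ∃ x ∈ T, x ∈ ({b} : Set V) := ⟨b, hb, rfl⟩
  have hdis : ∀ M M', MinFrag G T {b} M → MinFrag G T {b} M' → M ≠ M' → ¬ (M ∩ M').Nonempty := by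
    intro M M' hM hM' hne h
    exact hne ((hM.subset hT hbT hM'.1 h).antisymm
      (hM'.subset hT hbT hM.1 (by rwa [Finset.inter_comm])))
  -- A third minimal fragment would give three pairwise nonadjacent neighbours of o, that is, a
  -- claw.
  have hall : ∀ D, Frag G T {b} D → M₁ ⊆ D ∨ M₂ ⊆ D := by
    intro D hD
    obtain ⟨M, hM, hMD⟩ := hD.exists_minFrag
    by_contra hcon
    have h1 : M ≠ M₁ := by rintro rfl; exact hcon (Or.inl hMD)
    have h2 : M ≠ M₂ := by rintro rfl; exact hcon (Or.inr hMD)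
    obtain ⟨x, hx, hxo⟩ := hmeet M hM.1
    obtain ⟨y, hy, hyo⟩ := hmeet M₁ hM₁.1
    obtain ⟨z, hz, hzo⟩ := hmeet M₂ hM₂.1
    have d1 := hdis M M₁ hM hM₁ h1
    have d2 := hdis M M₂ hM hM₂ h2
    have d3 := hdis M₁ M₂ hM₁ hM₂ hne
    rcases hclaw x (hM.1.1 hx) y (hM₁.1.1 hy) z (hM₂.1.1 hz) hxo hyo hzo
      (by rintro rfl; exact d1 ⟨x, by grind⟩) (by rintro rfl; exact d2 ⟨x, by grind⟩)
      (by rintro rfl; exact d3 ⟨y, by grind⟩) with h | h | h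
    · exact hM.1.not_adj hT hbT hM₁.1 d1 hx hy h
    · exact hM.1.not_adj hT hbT hM₂.1 d2 hx hz h
    · exact hM₁.1.not_adj hT hbT hM₂.1 d3 hy hz h
  have d3 := hdis M₁ M₂ hM₁ hM₂ hne
  have d3' : ¬ (M₂ ∩ M₁).Nonempty := by rwa [Finset.inter_comm]
  obtain ⟨D₁, hD₁, hMD₁, hdis₁, hmax₁⟩ := exists_maxFrag hM₁.1 d3
  obtain ⟨D₂, hD₂, hMD₂, hdis₂, hmax₂⟩ := exists_maxFrag hM₂.1 d3'
  have hD : ¬ (D₁ ∩ D₂).Nonempty := by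
    intro h
    have hf := hD₁.inter hT hbT hD₂ h
    rcases hall _ hf with h | h
    · obtain ⟨x, hx⟩ := hM₁.1.2.1
      exact hdis₂ ⟨x, by grind⟩
    · obtain ⟨x, hx⟩ := hM₂.1.2.1
      exact hdis₁ ⟨x, by grind⟩
  have hD' : ∀ x ∈ D₁, x ∉ D₂ := fun x hx hx' => hD ⟨x, by grind⟩
  obtain ⟨c₁, hc₁⟩ := hD₁.2.2.2
  obtain ⟨c₂, hc₂⟩ := hD₂.2.2.2
  have ch₁ := hT.side hb hmeet hall hM₁ hM₂ hD₁ hdis₁ hc₁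
  have ch₂ := hT.side hb hmeet (fun D h => (hall D h).symm) hM₂ hM₁ hD₂ hdis₂ hc₂
  have hc₁₂ : c₁ ∉ D₂ := by
    intro h
    obtain ⟨x, hx, hxc⟩ := ch₁.right
    exact hD₁.not_adj hT hbT hD₂ hD hx h hxc.symm
  have hc₂₁ : c₂ ∉ D₁ := by
    intro h
    obtain ⟨x, hx, hxc⟩ := ch₂.right
    exact hD₁.not_adj hT hbT hD₂ hD h hx hxc
  refine ⟨D₁, D₂, c₁, c₂, ⟨hD₁.1, hD₂.1, hD', hb, fun h => hD₁.2.2.1 b h rfl,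
    fun h => hD₂.2.2.1 b h rfl, hc₁.1, hc₁.2.1, hc₁₂, hc₂.1, hc₂₁, hc₂.2.1, hc₁.2.2, hc₂.2.2,
    ch₁, ch₂, ?_, ?_, ?_, ?_⟩⟩
  · exact hT.core hb hall hM₁ hM₂ hMD₁ hMD₂ hD₁ hD₂ hD' hmax₂ hc₁ hc₂ hc₁₂ hc₂₁
  · rw [Finset.union_comm]
    exact hT.core hb (fun D h => (hall D h).symm) hM₂ hM₁ hMD₂ hMD₁ hD₂ hD₁
      (fun x hx hx' => hD' x hx' hx) hmax₁ hc₂ hc₁ hc₂₁ hc₁₂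
  · exact hT.rest hb hmeet (fun D h => (hall D h).symm) hM₂ hM₁ hMD₂ hMD₁ hD₁
      (fun x hx hx' => hD' x hx' hx) hmax₁ hc₁
  · exact hT.rest hb hmeet hall hM₁ hM₂ hMD₁ hMD₂ hD₂ hD' hmax₂ hc₂

/-! ### Peeling off an end -/

/-- Removing the end `a` of a chain leaves a chain with a new end adjacent to `a`, or a branch. -/
theorem Chain.peel {T : Finset V} {a b : V} (h : Chain G T {a} {b}) (hab : a ≠ b)
    (hcard : 3 ≤ T.card) (hclaw : NoClawAt G (T.erase a) a) :
    (∃ a' ∈ T.erase a, G.Adj a a' ∧ a' ≠ b ∧ Chain G (T.erase a) {a'} {b}) ∨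
    ∃ D₁ D₂ c₁ c₂, Branch G (T.erase a) a b D₁ D₂ c₁ c₂ := by
  obtain ⟨_, haT, rfl⟩ := h.left
  obtain ⟨_, hbT, rfl⟩ := h.right
  rename_i a b
  have hconn : Conn G (T.erase a) := by
    refine ⟨⟨b, by grind⟩, fun D hD hne hcl => ?_⟩
    by_contra hneq
    have hmem : b ∈ D := by
      by_contra hbD
      obtain ⟨x, hx, rfl⟩ := h.meets D ⟨hD.trans (Finset.erase_subset _ _), hne,
        fun x hx hxb => hbD (hxb ▸ hx), a, haT, by grind, fun x hx y hy hxy => by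
          have := hcl x hx y
          grind⟩
      have := hD hx
      grind
    obtain ⟨x, hx, rfl⟩ := h.meets (T.erase a \ D) ⟨by grind, by
        rw [Finset.sdiff_nonempty]
        exact fun h' => hneq (hD.antisymm h'), by
        rintro x hx rfl
        grind, a, haT, by grind, fun x hx y hy hxy => by
          have := hcl y
          have := hxy.symm
          grind⟩
    grind
  have hmeet : ∀ D, Frag G (T.erase a) {b} D → ∃ x ∈ D, x ∈ G.neighborSet a := by
    rintro D ⟨hDD, hne, hDb, c, hc, hcD, hcl⟩
    by_contra hcon
    push Not at hcon
    obtain ⟨x, hx, rfl⟩ := h.meets D ⟨hDD.trans (Finset.erase_subset _ _), hne, hDb, c, by grind,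
      hcD, fun x hx y hy hxy => by
        by_cases hya : y = a
        · subst hya
          exact (hcon x hx hxy.symm).elim
        · exact hcl x hx y (by grind) hxy⟩
    have := hDD hx
    grind
  by_cases hpair : ∀ M M', MinFrag G (T.erase a) {b} M → MinFrag G (T.erase a) {b} M' → M = M'
  · left
    -- Otherwise all of T except a and b is sealed off by b without containing a.
    have hnb : ∃ a' ∈ T.erase a, a' ∈ G.neighborSet a ∧ a' ≠ b := by
      by_contra hcon
      push Not at hcon
      obtain ⟨x, hx, rfl⟩ := h.meets ((T.erase a).erase b) ⟨by grind, by
          rw [← Finset.card_pos, Finset.card_erase_of_mem (by grind), Finset.card_erase_of_mem haT]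
          omega, by rintro x hx rfl; grind, b, hbT, by grind, fun x hx y hy hxy => by
          by_cases hya : y = a
          · subst hya
            have := hcon x (by grind) hxy.symm
            grind
          · grind⟩
      grind
    obtain ⟨a', h1, h2, h3, h4⟩ :=
      exists_chain_singleton (B := {b}) hconn ⟨b, by grind, rfl⟩ hmeet hpair (z := b) rfl hnb
    exact ⟨a', h1, h2, h3, h4⟩
  · right
    push Not at hpair
    obtain ⟨M, M', hM, hM', hne⟩ := hpair
    exact exists_branch hconn (by grind) hmeet hclaw hM hM' hne

/-! ### Partitions into three-vertex paths, and claws at the ends -/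

/-- `S` is a disjoint union of vertex sets of three-vertex paths of `G`. -/
inductive Fac (G : SimpleGraph V) : Finset V → Prop
  | empty : Fac G ∅
  | add {S : Finset V} {x y z : V} (hS : Fac G S) (hx : x ∉ S) (hy : y ∉ S) (hz : z ∉ S)
      (hxy : G.Adj x y) (hyz : G.Adj y z) (hxz : x ≠ z) : Fac G (S ∪ {x, y, z})

theorem Fac.union {S T : Finset V} (hS : Fac G S) (hT : Fac G T) (h : ∀ x ∈ S, x ∉ T) :
    Fac G (S ∪ T) := by
  induction hS with
  | empty => simpa using hT
  | @add S x y z hS hx hy hz hxy hyz hxz ih =>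
    have := Fac.add (ih fun v hv => h v (by grind)) (x := x) (y := y) (z := z)
      (by have := h x; grind) (by have := h y; grind) (by have := h z; grind) hxy hyz hxz
    rwa [Finset.union_right_comm]

theorem Fac.of_sdiff {S X : Finset V} (hX : Fac G X) (hXS : X ⊆ S) (h : Fac G (S \ X)) :
    Fac G S := by
  have := hX.union h (fun x hx => by grind)
  rwa [Finset.union_sdiff_of_subset hXS] at this

theorem Fac.path {x y z : V} (hxy : G.Adj x y) (hyz : G.Adj y z) (hxz : x ≠ z) :
    Fac G {x, y, z} := by
  simpa using Fac.add Fac.empty (by simp) (by simp) (by simp) hxy hyz hxz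

/-- `S` induces a claw-free graph. -/
def CF (G : SimpleGraph V) (S : Finset V) : Prop := ∀ w ∈ S, NoClawAt G S w

theorem CF.mono {S T : Finset V} (h : CF G T) (hST : S ⊆ T) : CF G S :=
  fun w hw => (h w (hST hw)).mono hST

/-- Both `a` and `b` are leaves of every claw in `S`. -/
def EndClaws (G : SimpleGraph V) (S : Finset V) (a b : V) : Prop :=
  ∀ w ∈ S, ∀ X ⊆ S, ¬ NoClawAt G X w → a ∈ X ∧ b ∈ X

theorem EndClaws.mono {S T : Finset V} {a b : V} (h : EndClaws G T a b) (hST : S ⊆ T) :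
    EndClaws G S a b := fun w hw X hX => h w (hST hw) X (hX.trans hST)

theorem CF.endClaws {S : Finset V} (h : CF G S) (a b : V) : EndClaws G S a b :=
  fun w hw _ hX hcl => (hcl ((h w hw).mono hX)).elim

theorem EndClaws.noClawAt_left {S : Finset V} {a b : V} (h : EndClaws G S a b) {w : V}
    (hw : w ∈ S) : NoClawAt G (S.erase a) w := by
  by_contra hcon
  have := (h w hw _ (Finset.erase_subset _ _) hcon).1
  grind

theorem EndClaws.noClawAt_right {S : Finset V} {a b : V} (h : EndClaws G S a b) {w : V}
    (hw : w ∈ S) : NoClawAt G (S.erase b) w := by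
  by_contra hcon
  have := (h w hw _ (Finset.erase_subset _ _) hcon).2
  grind

/-- Once either end is gone no claw is left; so every piece missing an end is claw-free. -/
theorem EndClaws.cf_left {S : Finset V} {a b : V} (h : EndClaws G S a b) : CF G (S.erase a) :=
  fun _ hw => h.noClawAt_left (Finset.mem_of_mem_erase hw)

theorem EndClaws.cf_right {S : Finset V} {a b : V} (h : EndClaws G S a b) : CF G (S.erase b) :=
  fun _ hw => h.noClawAt_right (Finset.mem_of_mem_erase hw)

theorem Chain.mono_right {S : Finset V} {A B B' : Set V} (h : Chain G S A B)
    (hB : ∀ x ∈ S, x ∈ B → x ∈ B') : Chain G S A B' := (h.symm.mono_left hB).symm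

/-! ### Cliques and chains inside a branch -/

namespace Branch

variable {T : Finset V} {o b : V} {D₁ D₂ : Finset V} {c₁ c₂ : V}

theorem card (h : Branch G T o b D₁ D₂ c₁ c₂) :
    T.card = D₁.card + D₂.card + (T \ (D₁ ∪ D₂)).card := by
  rw [← Finset.card_union_of_disjoint (Finset.disjoint_left.2 h.disj), add_comm,
    Finset.card_sdiff_add_card_eq_card (Finset.union_subset h.sub₁ h.sub₂)]

theorem card_pos (h : Branch G T o b D₁ D₂ c₁ c₂) : 0 < D₁.card :=
  Finset.card_pos.2 h.chain₁.conn.1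

theorem not_adj (h : Branch G T o b D₁ D₂ c₁ c₂) {x y : V} (hx : x ∈ D₁) (hy : y ∈ D₂) :
    ¬ G.Adj x y := by
  intro hxy
  rcases h.sealed₁ x hx y (h.sub₂ hy) hxy with h' | rfl
  · exact h.disj y h' hy
  · exact h.c₁₂ hy

theorem side (h : Branch G T o b D₁ D₂ c₁ c₂) :
    Chain G D₁ (G.neighborSet o ∩ ↑D₁) (G.neighborSet c₁ ∩ ↑D₁) :=
  (h.chain₁.mono_left (A' := G.neighborSet o ∩ ↑D₁) fun _ hx hx' => ⟨hx', hx⟩).mono_right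
    fun _ hx hx' => ⟨hx', hx⟩

/-- Two nonadjacent neighbours of o in D₁ would form a claw with a neighbour of o in D₂. -/
theorem isClique_apex (h : Branch G T o b D₁ D₂ c₁ c₂) (hcl : NoClawAt G (D₁ ∪ D₂) o) :
    G.IsClique (G.neighborSet o ∩ ↑D₁) := by
  rintro x ⟨hxo, hx⟩ y ⟨hyo, hy⟩ hxy
  obtain ⟨z, hz, hzo⟩ := h.chain₂.left
  have hx' : x ∈ D₁ := hx
  have hy' : y ∈ D₁ := hy
  rcases hcl x (by grind) y (by grind) z (by grind) hxo hyo hzo hxy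
    (by rintro rfl; exact h.disj x hx' hz) (by rintro rfl; exact h.disj y hy' hz) with h' | h' | h'
  · exact h'
  · exact (h.not_adj hx' hz h').elim
  · exact (h.not_adj hy' hz h').elim

/-- Otherwise c₁ would be isolated in T \ D₁, which is connected and also contains D₂. -/
theorem exists_adj_attach (h : Branch G T o b D₁ D₂ c₁ c₂) :
    ∃ r ∈ T, r ∉ D₁ ∧ r ≠ c₁ ∧ G.Adj c₁ r := by
  by_contra hcon
  push Not at hcon
  have := h.rest₂.conn.2 {c₁} (by have := h.c₁_mem; have := h.c₁₁; grind) (by simp) (by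
    intro x hx y hy hxy
    rw [Finset.mem_singleton] at hx
    subst hx
    by_contra hyx
    exact hcon y (by grind) (by grind) (by grind) hxy)
  obtain ⟨z, hz⟩ := h.chain₂.conn.1
  have h1 : z ∈ T \ D₁ := by
    have := h.disj z
    have := h.sub₂ hz
    grind
  rw [← this] at h1
  have := h.c₁₂
  grind

/-- The third leaf of the forbidden claw is a neighbour of c₁ outside D₁. -/
theorem isClique_attach (h : Branch G T o b D₁ D₂ c₁ c₂) (hcl : NoClawAt G T c₁) :
    G.IsClique (G.neighborSet c₁ ∩ ↑D₁) := by
  rintro x ⟨hxo, hx⟩ y ⟨hyo, hy⟩ hxy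
  obtain ⟨r, hr, hr1, hr2, hr3⟩ := h.exists_adj_attach
  have hx' : x ∈ D₁ := hx
  have hy' : y ∈ D₁ := hy
  have h1 := h.sealed₁ x hx' r hr
  have h2 := h.sealed₁ y hy' r hr
  rcases hcl x (h.sub₁ hx) y (h.sub₁ hy) r hr hxo hyo hr3 hxy
    (by rintro rfl; exact hr1 hx') (by rintro rfl; exact hr1 hy') with h' | h' | h'
  · exact h'
  · exact ((h1 h').elim hr1 hr2).elim
  · exact ((h2 h').elim hr1 hr2).elim

/-- The third leaf of the forbidden claw is a neighbour of c₁ in D₁. -/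
theorem isClique_attach_core (h : Branch G T o b D₁ D₂ c₁ c₂) (hcl : NoClawAt G T c₁) :
    G.IsClique (G.neighborSet c₁ ∩ ↑(T \ (D₁ ∪ D₂))) := by
  rintro x ⟨hxo, hx⟩ y ⟨hyo, hy⟩ hxy
  obtain ⟨r, hr, hrc⟩ := h.chain₁.right
  have hx' : x ∈ T \ (D₁ ∪ D₂) := hx
  have hy' : y ∈ T \ (D₁ ∪ D₂) := hy
  have h1 := h.sealed₁ r hr x (by grind)
  have h2 := h.sealed₁ r hr y (by grind)
  have h3 : x ≠ c₁ := fun h => G.loopless.irrefl c₁ (h ▸ hxo)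
  have h4 : y ≠ c₁ := fun h => G.loopless.irrefl c₁ (h ▸ hyo)
  rcases hcl x (by grind) y (by grind) r (h.sub₁ hr) hxo hyo hrc hxy
    (by rintro rfl; grind) (by rintro rfl; grind) with h' | h' | h'
  · exact h'
  · have := h1 h'.symm
    grind
  · have := h2 h'.symm
    grind

/-- A neighbour `u` of the apex is adjacent to all neighbours of the apex on one of the sides. -/
theorem complete (h : Branch G T o b D₁ D₂ c₁ c₂) {u : V} (hu : u ∉ T) (hou : G.Adj o u)
    (hcl : NoClawAt G (insert u (D₁ ∪ D₂)) o) :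
    (∀ x ∈ G.neighborSet o ∩ ↑D₁, G.Adj u x) ∨ (∀ x ∈ G.neighborSet o ∩ ↑D₂, G.Adj u x) := by
  by_contra hcon
  push Not at hcon
  obtain ⟨⟨x, ⟨hxo, hx⟩, hux⟩, y, ⟨hyo, hy⟩, huy⟩ := hcon
  have hx' : x ∈ D₁ := hx
  have hy' : y ∈ D₂ := hy
  rcases hcl u (by grind) x (by grind) y (by grind) hou hxo hyo
    (by rintro rfl; exact hu (h.sub₁ hx')) (by rintro rfl; exact hu (h.sub₂ hy'))
    (by rintro rfl; exact h.disj x hx' hy') with h' | h' | h'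
  · exact hux h'
  · exact huy h'
  · exact h.not_adj hx' hy' h'

theorem mem_core (h : Branch G T o b D₁ D₂ c₁ c₂) : c₁ ∈ T \ (D₁ ∪ D₂) := by
  have := h.c₁_mem
  have := h.c₁₁
  have := h.c₁₂
  grind

/-- Removing an attachment vertex keeps the core a chain. -/
theorem erase_core (h : Branch G T o b D₁ D₂ c₁ c₂) (hcl : NoClawAt G T c₁)
    (hcard : 2 ≤ (T \ (D₁ ∪ D₂)).card) :
    ∃ B, G.IsClique B ∧ Chain G ((T \ (D₁ ∪ D₂)).erase c₁) {c₂} B := by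
  have hc1 := h.mem_core
  have hc2 := h.swap.mem_core
  rw [Finset.union_comm] at hc2
  have hclq := h.isClique_attach_core hcl
  have hsub : T \ (D₁ ∪ D₂) ⊆ T := Finset.sdiff_subset
  have hD₁R : ∀ x ∈ T \ (D₁ ∪ D₂), x ∉ D₁ := fun x hx => by grind
  have hD₂R : ∀ x ∈ T \ (D₁ ∪ D₂), x ∉ D₂ := fun x hx => by grind
  have hbR : b ∈ T \ (D₁ ∪ D₂) := by
    have := h.b_mem
    have := h.b₁
    have := h.b₂
    grind
  have k1 := h.core₁
  have k2 := h.core₂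
  generalize hR : T \ (D₁ ∪ D₂) = R at *
  have hnb : ∃ r ∈ R, G.Adj c₁ r := by
    by_contra hcon
    push Not at hcon
    have := k1.conn.2 {c₁} (by simpa using hc1) (by simp) (by
      intro x hx y hy hxy
      rw [Finset.mem_singleton] at hx
      subst hx
      exact (hcon y hy hxy).elim)
    rw [← this] at hcard
    simp at hcard
  obtain ⟨r, hr, hcr⟩ := hnb
  -- A common attachment vertex would be the centre of a claw with leaves in D₁, D₂ and the core.
  have hne : c₁ ≠ c₂ := by
    intro heq
    obtain ⟨x, hx, hxc⟩ := h.chain₁.right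
    obtain ⟨y, hy, hyc⟩ := h.chain₂.right
    rw [← heq] at hyc
    have h1 := h.sealed₁ x hx r (hsub hr)
    have h2 := h.sealed₂ y hy r (hsub hr)
    have h3 : r ≠ c₁ := fun h => G.loopless.irrefl c₁ (h ▸ hcr)
    have h4 := hD₁R r hr
    have h5 := hD₂R r hr
    have h6 := h.disj x hx
    rcases hcl x (h.sub₁ hx) y (h.sub₂ hy) r (hsub hr) hxc hyc hcr (by grind) (by grind) (by grind)
      with h' | h' | h'
    · exact h.not_adj hx hy h'
    · have := h1 h'
      grind
    · have := h2 h'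
      grind
  have hfrag : ∀ D ⊆ R.erase c₁, D.Nonempty → b ∉ D →
      (∀ x ∈ D, ∀ y ∈ R.erase c₁, G.Adj x y → y ∈ D) → False := by
    intro D hD hne hbD hcl'
    obtain ⟨x, hx, rfl⟩ := k1.meets D ⟨hD.trans (Finset.erase_subset _ _), hne,
      fun x hx hxb => hbD (hxb ▸ hx), c₁, hc1, by grind, fun x hx y hy hxy => by
        have := hcl' x hx y
        grind⟩
    grind
  have hconn : Conn G (R.erase c₁) := by
    refine ⟨⟨c₂, by grind⟩, fun D hD hDne hcl' => ?_⟩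
    by_contra hneq
    by_cases hbD : b ∈ D
    · refine hfrag ((R.erase c₁) \ D) Finset.sdiff_subset ?_ (by grind) ?_
      · rw [Finset.sdiff_nonempty]
        exact fun h' => hneq (hD.antisymm h')
      · intro x hx y hy hxy
        have := hcl' y
        have := hxy.symm
        grind
    · exact hfrag D hD hDne hbD hcl'
  -- a part that is sealed off without touching the neighbours of `c₁`
  have hfar : ∀ D ⊆ R.erase c₁, D.Nonempty → b ∉ D → (∀ x ∈ D, ¬ G.Adj c₁ x) → ∀ c ∈ R.erase c₁,
      c ∉ D → (∀ x ∈ D, ∀ y ∈ R.erase c₁, G.Adj x y → y ∈ D ∨ y = c) → False := by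
    intro D hD hDne hbD hadj c hc hcD hcl'
    obtain ⟨x, hx, rfl⟩ := k1.meets D ⟨hD.trans (Finset.erase_subset _ _), hDne,
      fun x hx hxb => hbD (hxb ▸ hx), c, by grind, hcD, fun x hx y hy hxy => by
        have := hcl' x hx y
        have := hadj x hx
        have := hxy.symm
        grind⟩
    grind
  -- If the terminal b itself is removed, its neighbours in the core, which form a clique, take over
  -- its role.
  by_cases hcb : c₁ = b
  · refine ⟨_, hclq, hconn, ⟨c₂, by grind, rfl⟩, ⟨r, ?_, hcr, hr⟩, ?_⟩
    · have h3 : r ≠ c₁ := fun h => G.loopless.irrefl c₁ (h ▸ hcr)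
      grind
    · rintro D ⟨hD, hDne, hDB, c, hc, hcD, hcl'⟩
      refine (hfar D hD hDne (by grind) (fun x hx hxc => hDB x hx ⟨hxc, ?_⟩) c hc hcD hcl').elim
      exact Finset.mem_of_mem_erase (hD hx)
  · refine ⟨{b}, by simp, hconn, ⟨c₂, by grind, rfl⟩, ⟨b, by grind, rfl⟩, ?_⟩
    rintro D ⟨hD, hDne, hDB, c, hc, hcD, hcl'⟩
    have hbD : b ∉ D := fun h => hDB b h rfl
    have hp : ∃ p ∈ D, G.Adj c₁ p := by
      by_contra hcon
      push Not at hcon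
      exact hfar D hD hDne hbD hcon c hc hcD hcl'
    obtain ⟨p, hpD, hpc⟩ := hp
    -- The core neighbours of c₁ form a clique containing p, so they lie in D or equal c; hence c
    -- still seals D together with c₁, and this fragment contains c₂ ≠ c₁.
    obtain ⟨x, hx, rfl⟩ := k2.meets (insert c₁ D) ⟨by grind, by simp, by
      intro x hx
      simp only [Set.mem_singleton_iff]
      grind, c, by grind, by grind, by
      intro x hx y hy hxy
      have hxp : x = c₁ → y ≠ p → G.Adj p y := by
        rintro rfl hyp
        exact hclq ⟨hpc, Finset.mem_of_mem_erase (hD hpD)⟩ ⟨hxy, hy⟩ hyp.symm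
      have h1 := hcl' p hpD y
      have h2 := hcl' x
      grind⟩
    exact ⟨x, by grind, rfl⟩

end Branch

/-- The main statement for all sets with fewer than `n` vertices. -/
def FacBelow (G : SimpleGraph V) (n : ℕ) : Prop :=
  ∀ S : Finset V, ∀ a b : V, S.card < n → 3 ∣ S.card → Chain G S {a} {b} → a ≠ b →
    EndClaws G S a b → Fac G S

/-- Shrinking each clique to one vertex, the second chosen different from the first, gives the two
distinct ends that the induction needs. -/
theorem FacBelow.clique {n : ℕ} (h : FacBelow G n) {S : Finset V} {A B : Set V} (hlt : S.card < n)
    (h3 : 3 ∣ S.card) (hS : Chain G S A B) (hA : G.IsClique A) (hB : G.IsClique B)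
    (hcf : CF G S) : Fac G S := by
  have hpos : 0 < S.card := Finset.card_pos.2 hS.conn.1
  have hcard : 2 ≤ S.card := by omega
  obtain ⟨z, -, hz⟩ := hS.right
  obtain ⟨a, haS, -, ha⟩ := hS.exists_singleton (fun x _ y _ hx hy hxy => hA hx hy hxy) hcard hz
  obtain ⟨b, hbS, hba, hb⟩ := ha.symm.exists_singleton (fun x _ y _ hx hy hxy => hB hx hy hxy) hcard
    (z := a) rfl
  exact h S a b hlt h3 hb.symm hba.symm (hcf.endClaws a b)

namespace Branch

variable {T : Finset V} {o b : V} {D₁ D₂ : Finset V} {c₁ c₂ : V}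

theorem card_sdiff (h : Branch G T o b D₁ D₂ c₁ c₂) :
    (T \ D₁).card + D₁.card = T.card :=
  Finset.card_sdiff_add_card_eq_card h.sub₁

theorem fac_side (h : Branch G T o b D₁ D₂ c₁ c₂) {n : ℕ} (ih : FacBelow G n) (hn : T.card < n)
    (hcf : CF G T) (ho : NoClawAt G (D₁ ∪ D₂) o) (h3 : 3 ∣ D₁.card) : Fac G D₁ := by
  have := h.card
  exact ih.clique (by omega) h3 h.side (h.isClique_apex ho)
    (h.isClique_attach (hcf _ h.c₁_mem)) (hcf.mono h.sub₁)

theorem swap_noClawAt {w : V} (ho : NoClawAt G (D₁ ∪ D₂) w) : NoClawAt G (D₂ ∪ D₁) w := by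
  rwa [Finset.union_comm]

/-- The chain formed by both sides and the apex. -/
theorem chain_through (h : Branch G T o b D₁ D₂ c₁ c₂) {X : Finset V} {B : Set V}
    (hX : Chain G X {o} B) (hdisj : ∀ x ∈ X, x ∉ D₂) :
    Chain G (X ∪ D₂) B (G.neighborSet c₂ ∩ ↑D₂) :=
  hX.glue (h.swap.side.mono_left fun _ _ hx => hx.1) hdisj

end Branch

/-! ### Cutting a branch according to residues modulo 3 -/

section Steps

variable {S : Finset V} {a a' a'' b : V} {D₁ D₂ : Finset V} {c₁ c₂ : V} {n : ℕ}

/-- A branch appears after the removal of one vertex; one side can be split off. -/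
theorem fac_of_branch_one_side (ih : FacBelow G n) (hn : S.card = n) (h3 : 3 ∣ S.card)
    (haS : a ∈ S) (hab : a ≠ b) (hcl : EndClaws G S a b)
    (hB : Branch G (S.erase a) a b D₁ D₂ c₁ c₂) (hD : D₁.card % 3 ≠ 1) : Fac G S := by
  have hcard := Finset.card_erase_add_one haS
  have hsum := hB.card_sdiff
  have hpos := hB.card_pos
  have hsub := hB.sub₁
  have ha1 : a ∉ D₁ := fun h => by have := hsub h; grind
  have hb1 := hB.b₁
  have hsub2 := hB.sub₂
  have hap : NoClawAt G (D₁ ∪ D₂) a := (hcl.noClawAt_left haS).mono (by grind)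
  have hT : CF G (S.erase a) := hcl.cf_left
  have hq1 := hB.isClique_apex hap
  have hq2 := hB.swap.isClique_apex (Branch.swap_noClawAt hap)
  have hq3 := hB.isClique_attach (hT _ hB.c₁_mem)
  -- With residue 0 the side splits off alone and a stays with the rest; with residue 2 the side
  -- takes a along.
  by_cases h0 : D₁.card % 3 = 0
  · refine (hB.fac_side ih (by omega) hT hap (by omega)).of_sdiff
      (hsub.trans (Finset.erase_subset _ _)) ?_
    have heq : S \ D₁ = insert a (S.erase a \ D₁) := by ext x; grind
    have hc : (insert a (S.erase a \ D₁)).card = (S.erase a \ D₁).card + 1 :=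
      Finset.card_insert_of_notMem (by grind)
    rw [heq]
    refine ih _ a b (by omega) (by omega) (hB.rest₂.insert (by grind) fun x _ hx => hx.1) hab
      (hcl.mono (by grind))
  · have hc : (insert a D₁).card = D₁.card + 1 := Finset.card_insert_of_notMem ha1
    have hne : (S.erase a \ D₁).card > 0 := Finset.card_pos.2 hB.rest₂.conn.1
    have hX : insert a D₁ ⊆ S.erase b := by
      intro x hx
      have := @hsub x
      grind
    refine (ih.clique (by omega) (by omega) (hB.side.insert ha1 fun x _ hx => hx.1) (by simp) hq3
      (hcl.cf_right.mono hX)).of_sdiff (hX.trans (Finset.erase_subset _ _)) ?_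
    have heq : S \ insert a D₁ = S.erase a \ D₁ := by ext x; grind
    rw [heq]
    exact ih.clique (by omega) (by omega) hB.rest₂ hq2 (by simp) (hT.mono Finset.sdiff_subset)

/-- A branch appears after the removal of one vertex. -/
theorem fac_of_branch_one (ih : FacBelow G n) (hn : S.card = n) (h3 : 3 ∣ S.card)
    (haS : a ∈ S) (hab : a ≠ b) (hcl : EndClaws G S a b)
    (hB : Branch G (S.erase a) a b D₁ D₂ c₁ c₂) : Fac G S := by
  by_cases hD₁ : D₁.card % 3 = 1
  swap
  · exact fac_of_branch_one_side ih hn h3 haS hab hcl hB hD₁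
  by_cases hD₂ : D₂.card % 3 = 1
  swap
  · exact fac_of_branch_one_side ih hn h3 haS hab hcl hB.swap hD₂
  have hcard := Finset.card_erase_add_one haS
  have hsum := hB.card
  have hsub := hB.sub₁
  have hsub2 := hB.sub₂
  have hdisj := hB.disj
  have hb1 := hB.b₁
  have hb2 := hB.b₂
  have ha1 : a ∉ D₁ := fun h => by have := hsub h; grind
  have ha2 : a ∉ D₂ := fun h => by have := hsub2 h; grind
  have hT : CF G (S.erase a) := hcl.cf_left
  have hq1 := hB.isClique_attach (hT _ hB.c₁_mem)
  have hq2 := hB.swap.isClique_attach (hT _ hB.c₂_mem)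
  have hc : (insert a D₁ ∪ D₂).card = D₁.card + 1 + D₂.card := by
    rw [Finset.card_union_of_disjoint (Finset.disjoint_left.2 (by grind)),
      Finset.card_insert_of_notMem ha1]
  have hX : insert a D₁ ∪ D₂ ⊆ S.erase b := by
    intro x hx
    have := @hsub x
    have := @hsub2 x
    grind
  have hne : (S.erase a \ (D₁ ∪ D₂)).card > 0 := Finset.card_pos.2 hB.core₁.conn.1
  -- Both residues are 1: the sides joined through a form a chain of size divisible by 3, and the
  -- core is left as a chain from c₁ to b.
  refine (ih.clique (by omega) (by omega) (hB.chain_through (hB.side.insert ha1 fun x _ hx => hx.1)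
    (by grind)) hq1 hq2 (hcl.cf_right.mono hX)).of_sdiff (hX.trans (Finset.erase_subset _ _)) ?_
  have heq : S \ (insert a D₁ ∪ D₂) = S.erase a \ (D₁ ∪ D₂) := by ext x; grind
  rw [heq]
  exact ih.clique (by omega) (by omega) hB.core₁ (by simp) (by simp) (hT.mono Finset.sdiff_subset)

/-- A branch appears after the removal of two vertices; one side can be split off. -/
theorem fac_of_branch_two_side (ih : FacBelow G n) (hn : S.card = n) (h3 : 3 ∣ S.card)
    (haS : a ∈ S) (ha' : a' ∈ S.erase a) (haa' : G.Adj a a') (hab : a ≠ b) (ha'b : a' ≠ b)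
    (hcl : EndClaws G S a b)
    (hB : Branch G ((S.erase a).erase a') a' b D₁ D₂ c₁ c₂) (hD : D₁.card % 3 ≠ 2) :
    Fac G S := by
  have hcard := Finset.card_erase_add_one haS
  have hcard' := Finset.card_erase_add_one ha'
  have hsum := hB.card_sdiff
  have hpos := hB.card_pos
  have hsub := hB.sub₁
  have hsub2 := hB.sub₂
  have hb1 := hB.b₁
  have ha1 : a ∉ D₁ := fun h => by have := hsub h; grind
  have ha1' : a' ∉ D₁ := fun h => by have := hsub h; grind
  have hT : CF G ((S.erase a).erase a') := hcl.cf_left.mono (Finset.erase_subset _ _)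
  have hap : NoClawAt G (D₁ ∪ D₂) a' := (hcl.cf_left a' ha').mono (by grind)
  have hq2 := hB.swap.isClique_apex (Branch.swap_noClawAt hap)
  have hq3 := hB.isClique_attach (hT _ hB.c₁_mem)
  -- With residue 0 the side splits off alone; with residue 1 it takes both a and a' along.
  by_cases h0 : D₁.card % 3 = 0
  · refine (hB.fac_side ih (by omega) hT hap (by omega)).of_sdiff (by grind) ?_
    have heq : S \ D₁ = insert a (insert a' ((S.erase a).erase a' \ D₁)) := by ext x; grind
    have hc : (insert a (insert a' ((S.erase a).erase a' \ D₁))).card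
        = ((S.erase a).erase a' \ D₁).card + 1 + 1 := by
      rw [Finset.card_insert_of_notMem (by grind), Finset.card_insert_of_notMem (by grind)]
    rw [heq]
    refine ih _ a b (by omega) (by omega) ((hB.rest₂.insert (by grind) fun x _ hx => hx.1).insert
      (by grind) ?_) hab (hcl.mono (by grind))
    rintro x - rfl
    exact haa'
  · have hc : (insert a (insert a' D₁)).card = D₁.card + 1 + 1 := by
      rw [Finset.card_insert_of_notMem (by grind), Finset.card_insert_of_notMem (by grind)]
    have hne : ((S.erase a).erase a' \ D₁).card > 0 := Finset.card_pos.2 hB.rest₂.conn.1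
    have hX : insert a (insert a' D₁) ⊆ S.erase b := by
      intro x hx
      have := @hsub x
      grind
    refine (ih.clique (by omega) (by omega) ((hB.side.insert ha1' fun x _ hx => hx.1).insert
      (by grind) ?_) (by simp) hq3 (hcl.cf_right.mono hX)).of_sdiff
      (hX.trans (Finset.erase_subset _ _)) ?_
    · rintro x - rfl
      exact haa'
    have heq : S \ insert a (insert a' D₁) = (S.erase a).erase a' \ D₁ := by ext x; grind
    rw [heq]
    exact ih.clique (by omega) (by omega) hB.rest₂ hq2 (by simp) (hT.mono Finset.sdiff_subset)

/-- A branch appears after the removal of two vertices, the first one being adjacent to all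
neighbours of the second one on one side. -/
theorem fac_of_branch_two_through (ih : FacBelow G n) (hn : S.card = n) (h3 : 3 ∣ S.card)
    (haS : a ∈ S) (ha' : a' ∈ S.erase a) (haa' : G.Adj a a') (hab : a ≠ b) (ha'b : a' ≠ b)
    (hcl : EndClaws G S a b)
    (hB : Branch G ((S.erase a).erase a') a' b D₁ D₂ c₁ c₂) (hD₁ : D₁.card % 3 = 2)
    (hD₂ : D₂.card % 3 = 2) (hcomp : ∀ x ∈ G.neighborSet a' ∩ ↑D₁, G.Adj a x) :
    Fac G S := by
  have hcard := Finset.card_erase_add_one haS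
  have hcard' := Finset.card_erase_add_one ha'
  have hsum := hB.card
  have hsub := hB.sub₁
  have hsub2 := hB.sub₂
  have hdisj := hB.disj
  have hb1 := hB.b₁
  have hb2 := hB.b₂
  have ha1 : a ∉ D₁ := fun h => by have := hsub h; grind
  have ha1' : a' ∉ D₁ := fun h => by have := hsub h; grind
  have ha2 : a ∉ D₂ := fun h => by have := hsub2 h; grind
  have ha2' : a' ∉ D₂ := fun h => by have := hsub2 h; grind
  have hT : CF G ((S.erase a).erase a') := hcl.cf_left.mono (Finset.erase_subset _ _)
  have hq1 := hB.isClique_attach (hT _ hB.c₁_mem)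
  have hq2 := hB.swap.isClique_attach (hT _ hB.c₂_mem)
  have hc : (insert a' (insert a D₁) ∪ D₂).card = D₁.card + 1 + 1 + D₂.card := by
    rw [Finset.card_union_of_disjoint (Finset.disjoint_left.2 (by grind)),
      Finset.card_insert_of_notMem (by grind), Finset.card_insert_of_notMem ha1]
  have hX : insert a' (insert a D₁) ∪ D₂ ⊆ S.erase b := by
    intro x hx
    have := @hsub x
    have := @hsub2 x
    grind
  have hne : ((S.erase a).erase a' \ (D₁ ∪ D₂)).card > 0 := Finset.card_pos.2 hB.core₁.conn.1
  -- The order is D₁, a, a', D₂, with residues 2 + 1 + 1 + 2; by `hcomp` the vertex a can stand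
  -- between D₁ and a'.
  refine (ih.clique (by omega) (by omega) (hB.chain_through
    ((hB.side.insert ha1 fun x _ hx => hcomp x hx).insert (o := a') (by grind) ?_)
    (by grind)) hq1 hq2 (hcl.cf_right.mono hX)).of_sdiff (hX.trans (Finset.erase_subset _ _)) ?_
  · rintro x - rfl
    exact haa'.symm
  have heq : S \ (insert a' (insert a D₁) ∪ D₂) = (S.erase a).erase a' \ (D₁ ∪ D₂) := by
    ext x; grind
  rw [heq]
  exact ih.clique (by omega) (by omega) hB.core₁ (by simp) (by simp) (hT.mono Finset.sdiff_subset)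

/-- A branch appears after the removal of two vertices. -/
theorem fac_of_branch_two (ih : FacBelow G n) (hn : S.card = n) (h3 : 3 ∣ S.card)
    (haS : a ∈ S) (ha' : a' ∈ S.erase a) (haa' : G.Adj a a') (hab : a ≠ b) (ha'b : a' ≠ b)
    (hcl : EndClaws G S a b)
    (hB : Branch G ((S.erase a).erase a') a' b D₁ D₂ c₁ c₂) : Fac G S := by
  by_cases hD₁ : D₁.card % 3 = 2
  swap
  · exact fac_of_branch_two_side ih hn h3 haS ha' haa' hab ha'b hcl hB hD₁
  by_cases hD₂ : D₂.card % 3 = 2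
  swap
  · exact fac_of_branch_two_side ih hn h3 haS ha' haa' hab ha'b hcl hB.swap hD₂
  have hX : insert a (D₁ ∪ D₂) ⊆ S.erase b := by
    intro x hx
    have := @hB.sub₁ x
    have := @hB.sub₂ x
    have := hB.b₁
    have := hB.b₂
    grind
  rcases hB.complete (u := a) (by grind) haa'.symm ((hcl.cf_right a' (by grind)).mono hX) with h | h
  · exact fac_of_branch_two_through ih hn h3 haS ha' haa' hab ha'b hcl hB hD₁ hD₂ h
  · exact fac_of_branch_two_through ih hn h3 haS ha' haa' hab ha'b hcl hB.swap hD₂ hD₁ h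

/-- A branch appears after the removal of three vertices; a side of size divisible by three can be
split off. -/
theorem fac_of_branch_three_zero (ih : FacBelow G n) (hn : S.card = n) (h3 : 3 ∣ S.card)
    (haS : a ∈ S) (ha' : a' ∈ S.erase a) (ha'' : a'' ∈ (S.erase a).erase a')
    (haa' : G.Adj a a') (haa'' : G.Adj a' a'') (hab : a ≠ b)
    (hcl : EndClaws G S a b)
    (hB : Branch G (((S.erase a).erase a').erase a'') a'' b D₁ D₂ c₁ c₂)
    (hD : D₁.card % 3 = 0) : Fac G S := by
  have hcard := Finset.card_erase_add_one haS
  have hcard' := Finset.card_erase_add_one ha'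
  have hcard'' := Finset.card_erase_add_one ha''
  have hsum := hB.card_sdiff
  have hpos := hB.card_pos
  have hsub := hB.sub₁
  have hsub2 := hB.sub₂
  have hT : CF G (((S.erase a).erase a').erase a'') := hcl.cf_left.mono (by grind)
  have hap : NoClawAt G (D₁ ∪ D₂) a'' := (hcl.cf_left a'' (by grind)).mono (by grind)
  refine (hB.fac_side ih (by omega) hT hap (by omega)).of_sdiff (by grind) ?_
  have ha1 : a ∉ D₁ := fun h => by have := hsub h; grind
  have ha1' : a' ∉ D₁ := fun h => by have := hsub h; grind
  have ha1'' : a'' ∉ D₁ := fun h => by have := hsub h; grind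
  have heq : S \ D₁ = insert a (insert a' (insert a''
      (((S.erase a).erase a').erase a'' \ D₁))) := by ext x; grind
  have hc : (insert a (insert a' (insert a'' (((S.erase a).erase a').erase a'' \ D₁)))).card
      = (((S.erase a).erase a').erase a'' \ D₁).card + 1 + 1 + 1 := by
    rw [Finset.card_insert_of_notMem (by grind), Finset.card_insert_of_notMem (by grind),
      Finset.card_insert_of_notMem (by grind)]
  rw [heq]
  refine ih _ a b (by omega) (by omega) (((hB.rest₂.insert (by grind) fun x _ hx => hx.1).insert
    (o := a') (by grind) ?_).insert (by grind) ?_) hab (hcl.mono (by grind))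
  · rintro x - rfl
    exact haa''
  · rintro x - rfl
    exact haa'

/-- A branch appears after the removal of three vertices, the second one being adjacent to all
neighbours of the third one on the first side. -/
theorem fac_of_branch_three_complete (ih : FacBelow G n) (hn : S.card = n) (h3 : 3 ∣ S.card)
    (haS : a ∈ S) (ha' : a' ∈ S.erase a) (ha'' : a'' ∈ (S.erase a).erase a')
    (haa' : G.Adj a a') (haa'' : G.Adj a' a'') (hab : a ≠ b) (ha'b : a' ≠ b) (ha''b : a'' ≠ b)
    (hcl : EndClaws G S a b)
    (hB : Branch G (((S.erase a).erase a').erase a'') a'' b D₁ D₂ c₁ c₂)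
    (hcomp : ∀ x ∈ G.neighborSet a'' ∩ ↑D₁, G.Adj a' x) : Fac G S := by
  by_cases h10 : D₁.card % 3 = 0
  · exact fac_of_branch_three_zero ih hn h3 haS ha' ha'' haa' haa'' hab hcl hB h10
  by_cases h20 : D₂.card % 3 = 0
  · exact fac_of_branch_three_zero ih hn h3 haS ha' ha'' haa' haa'' hab hcl hB.swap h20
  have hcard := Finset.card_erase_add_one haS
  have hcard' := Finset.card_erase_add_one ha'
  have hcard'' := Finset.card_erase_add_one ha''
  have hsum := hB.card
  have hs1 := hB.card_sdiff
  have hs2 := hB.swap.card_sdiff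
  have hpos1 := hB.card_pos
  have hpos2 := hB.swap.card_pos
  have hsub := hB.sub₁
  have hsub2 := hB.sub₂
  have hdisj := hB.disj
  have hb1 := hB.b₁
  have hb2 := hB.b₂
  have ha1 : a ∉ D₁ := fun h => by have := hsub h; grind
  have ha1' : a' ∉ D₁ := fun h => by have := hsub h; grind
  have ha1'' : a'' ∉ D₁ := fun h => by have := hsub h; grind
  have ha2 : a ∉ D₂ := fun h => by have := hsub2 h; grind
  have ha2' : a' ∉ D₂ := fun h => by have := hsub2 h; grind
  have ha2'' : a'' ∉ D₂ := fun h => by have := hsub2 h; grind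
  have hT : CF G (((S.erase a).erase a').erase a'') := hcl.cf_left.mono (by grind)
  have hap : NoClawAt G (D₁ ∪ D₂) a'' := (hcl.cf_left a'' (by grind)).mono (by grind)
  have hp1 := hB.isClique_apex hap
  have hp2 := hB.swap.isClique_apex (Branch.swap_noClawAt hap)
  have hq1 := hB.isClique_attach (hT _ hB.c₁_mem)
  have hq2 := hB.swap.isClique_attach (hT _ hB.c₂_mem)
  have hne1 : (((S.erase a).erase a').erase a'' \ D₁).card > 0 :=
    Finset.card_pos.2 hB.rest₂.conn.1
  have hne2 : (((S.erase a).erase a').erase a'' \ D₂).card > 0 :=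
    Finset.card_pos.2 hB.rest₁.conn.1
  -- By `hcomp`, a' can replace a'' in front of D₁: a and a' leave with D₁, while a'' becomes the
  -- end of the rest.
  by_cases h11 : D₁.card % 3 = 1
  · have hc : (insert a (insert a' D₁)).card = D₁.card + 1 + 1 := by
      rw [Finset.card_insert_of_notMem (by grind), Finset.card_insert_of_notMem (by grind)]
    have hX : insert a (insert a' D₁) ⊆ S.erase b := by
      intro x hx
      have := @hsub x
      grind
    refine (ih.clique (by omega) (by omega) ((hB.side.insert ha1' fun x _ hx => hcomp x hx).insert
      (o := a) (by grind) ?_) (by simp) hq1 (hcl.cf_right.mono hX)).of_sdiff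
      (hX.trans (Finset.erase_subset _ _)) ?_
    · rintro x - rfl
      exact haa'
    have heq : S \ insert a (insert a' D₁) =
        insert a'' (((S.erase a).erase a').erase a'' \ D₁) := by ext x; grind
    have hc' : (insert a'' (((S.erase a).erase a').erase a'' \ D₁)).card =
        (((S.erase a).erase a').erase a'' \ D₁).card + 1 :=
      Finset.card_insert_of_notMem (by grind)
    rw [heq]
    exact ih.clique (by omega) (by omega) (hB.rest₂.insert (by grind) fun x _ hx => hx.1) (by simp)
      (by simp) (hcl.cf_left.mono (by grind))
  -- Here a'' leaves with D₂, and a, a' continue directly into D₁ by `hcomp`.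
  by_cases h22 : D₂.card % 3 = 2
  · have hc : (insert a'' D₂).card = D₂.card + 1 := Finset.card_insert_of_notMem ha2''
    have hX : insert a'' D₂ ⊆ S.erase b := by
      intro x hx
      have := @hsub2 x
      grind
    refine (ih.clique (by omega) (by omega) (hB.swap.side.insert ha2'' fun x _ hx => hx.1)
      (by simp) hq2 (hcl.cf_right.mono hX)).of_sdiff (hX.trans (Finset.erase_subset _ _)) ?_
    have heq : S \ insert a'' D₂ =
        insert a (insert a' (((S.erase a).erase a').erase a'' \ D₂)) := by ext x; grind
    have hc' : (insert a (insert a' (((S.erase a).erase a').erase a'' \ D₂))).card =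
        (((S.erase a).erase a').erase a'' \ D₂).card + 1 + 1 := by
      rw [Finset.card_insert_of_notMem (by grind), Finset.card_insert_of_notMem (by grind)]
    rw [heq]
    refine ih _ a b (by omega) (by omega) ((hB.rest₁.insert (o := a') (by grind)
      fun x _ hx => hcomp x hx).insert (o := a) (by grind) ?_) hab (hcl.mono (by grind))
    rintro x - rfl
    exact haa'
  -- now `D₁` has residue two and `D₂` has residue one
  have hcR : 0 < (((S.erase a).erase a').erase a'' \ (D₁ ∪ D₂)).card :=
    Finset.card_pos.2 hB.core₁.conn.1
  obtain ⟨B, hBcl, hBch⟩ := hB.erase_core (hT _ hB.c₁_mem) (by omega)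
  have hc1R := hB.mem_core
  have hc11 := hB.c₁₁
  have hc12 := hB.c₁₂
  have hcE := Finset.card_erase_add_one hc1R
  have hX : {a, a', a''} ⊆ S := by intro x hx; grind
  refine (Fac.path haa' haa'' (by grind)).of_sdiff hX ?_
  have hc1 : (insert c₁ D₁).card = D₁.card + 1 := Finset.card_insert_of_notMem hc11
  -- Three pieces: the path a a' a'', the side D₁ completed by c₁, and D₂ glued at c₂ to the core
  -- without c₁.
  refine Fac.of_sdiff (X := insert c₁ D₁) (ih.clique (by omega) (by omega)
    (hB.side.symm.insert hc11 fun x _ hx => hx.1) (by simp) hp1 (hT.mono (by grind)))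
    (by grind) ?_
  have heq : (S \ {a, a', a''}) \ insert c₁ D₁ =
      ((((S.erase a).erase a').erase a'' \ (D₁ ∪ D₂)).erase c₁) ∪ D₂ := by
    ext x
    have := @hsub2 x
    grind
  have hdis : ∀ x ∈ (((S.erase a).erase a').erase a'' \ (D₁ ∪ D₂)).erase c₁, x ∉ D₂ := by grind
  have hc2 := Finset.card_union_of_disjoint (Finset.disjoint_left.2 hdis)
  rw [heq]
  exact ih.clique (by omega) (by omega) (hBch.glue (hB.swap.side.symm.mono_left fun _ _ hx => hx.1)
    hdis) hBcl hp2 (hT.mono (by grind))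

/-- A branch appears after the removal of three vertices. -/
theorem fac_of_branch_three (ih : FacBelow G n) (hn : S.card = n) (h3 : 3 ∣ S.card)
    (haS : a ∈ S) (ha' : a' ∈ S.erase a) (ha'' : a'' ∈ (S.erase a).erase a')
    (haa' : G.Adj a a') (haa'' : G.Adj a' a'') (hab : a ≠ b) (ha'b : a' ≠ b) (ha''b : a'' ≠ b)
    (hcl : EndClaws G S a b)
    (hB : Branch G (((S.erase a).erase a').erase a'') a'' b D₁ D₂ c₁ c₂) : Fac G S := by
  have hX : insert a' (D₁ ∪ D₂) ⊆ S.erase b := by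
    intro x hx
    have := @hB.sub₁ x
    have := @hB.sub₂ x
    have := hB.b₁
    have := hB.b₂
    grind
  rcases hB.complete (u := a') (by grind) haa''.symm ((hcl.cf_right a'' (by grind)).mono hX)
    with h | h
  · exact fac_of_branch_three_complete ih hn h3 haS ha' ha'' haa' haa'' hab ha'b ha''b hcl hB h
  · exact fac_of_branch_three_complete ih hn h3 haS ha' ha'' haa' haa'' hab ha'b ha''b hcl hB.swap h

end Steps

/-! ### The induction on the size of the chain -/

theorem fac_of_facBelow {S : Finset V} {a b : V} (ih : FacBelow G S.card) (h3 : 3 ∣ S.card)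
    (hS : Chain G S {a} {b}) (hab : a ≠ b) (hcl : EndClaws G S a b) : Fac G S := by
  have haS : a ∈ S := by obtain ⟨x, hx, rfl⟩ := hS.left; exact hx
  have hbS : b ∈ S := by obtain ⟨x, hx, rfl⟩ := hS.right; exact hx
  have hpos : 0 < S.card := Finset.card_pos.2 ⟨a, haS⟩
  have hcard := Finset.card_erase_add_one haS
  rcases hS.peel hab (by omega) (hcl.noClawAt_left haS) with
    ⟨a', ha', haa', ha'b, hS'⟩ | ⟨D₁, D₂, c₁, c₂, hB⟩
  swap
  · exact fac_of_branch_one ih rfl h3 haS hab hcl hB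
  have hcard' := Finset.card_erase_add_one ha'
  by_cases hS3 : S.card = 3
  · have hadj : G.Adj a' b := by
      by_contra hcon
      have hb' : b ∈ (S.erase a).erase a' := by grind
      have h1 : (S.erase a).erase a' = {b} := by
        obtain ⟨x, hx⟩ := Finset.card_eq_one.1 (show ((S.erase a).erase a').card = 1 by omega)
        rw [hx, Finset.mem_singleton] at hb'
        rw [hx, hb']
      have := hS'.conn.2 {a'} (by simpa using ha') (by simp) (by
        intro x hx y hy hxy
        rw [Finset.mem_singleton] at hx
        subst hx
        by_contra hyx
        have : y ∈ (S.erase a).erase x := by grind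
        rw [h1, Finset.mem_singleton] at this
        exact hcon (this ▸ hxy))
      have : b ∈ ({a'} : Finset V) := by rw [this]; grind
      grind
    have := Fac.path haa' hadj hab
    have heq : ({a, a', b} : Finset V) = S := Finset.eq_of_subset_of_card_le (by grind) (by
      rw [hS3, Finset.card_eq_three.2 ⟨a, a', b, haa'.ne, hab, ha'b, rfl⟩])
    rwa [heq] at this
  rcases hS'.peel ha'b (by omega) ((hcl.cf_left a' ha').mono (Finset.erase_subset _ _)) with
    ⟨a'', ha'', haa'', ha''b, hS''⟩ | ⟨D₁, D₂, c₁, c₂, hB⟩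
  swap
  · exact fac_of_branch_two ih rfl h3 haS ha' haa' hab ha'b hcl hB
  have hcard'' := Finset.card_erase_add_one ha''
  -- This removal only has to leave a chain; its new end need not be joined to a''.
  rcases hS''.peel ha''b (by omega) ((hcl.cf_left a'' (by grind)).mono (by grind)) with
    ⟨e, -, -, heb, he⟩ | ⟨D₁, D₂, c₁, c₂, hB⟩
  swap
  · exact fac_of_branch_three ih rfl h3 haS ha' ha'' haa' haa'' hab ha'b ha''b hcl hB
  have hX : {a, a', a''} ⊆ S := by intro x hx; grind
  refine (Fac.path haa' haa'' (by grind)).of_sdiff hX ?_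
  have heq : S \ {a, a', a''} = ((S.erase a).erase a').erase a'' := by ext x; grind
  rw [heq]
  exact ih _ e b (by omega) (by omega) he heb (CF.endClaws (hcl.cf_left.mono (by grind)) _ _)

/-- A chain with two distinct ends whose only claws have both ends as leaves, and whose number of
vertices is divisible by three, is a disjoint union of three-vertex paths. -/
theorem Chain.fac {S : Finset V} {a b : V} (hS : Chain G S {a} {b}) (h3 : 3 ∣ S.card)
    (hab : a ≠ b) (hcl : EndClaws G S a b) : Fac G S := by
  have main : ∀ n, FacBelow G n := by
    intro n
    induction n with
    | zero => exact fun S a b h => (Nat.not_lt_zero _ h).elim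
    | succ n ihn =>
      intro S a b hlt h3 hS hab hcl
      exact fac_of_facBelow (fun S' a' b' h => ihn S' a' b' (by omega)) h3 hS hab hcl
  exact main _ S a b (Nat.lt_succ_self _) h3 hS hab hcl

/-! ### Choosing the ends of a chain -/

/-- If all fragments of `T`, with respect to any set of terminals, are adjacent to `o`, which is
not the centre of a claw, then `T` is a chain between two single vertices. -/
theorem exists_chain_ends {T : Finset V} {o : V} (hT : Conn G T)
    (hmeet : ∀ B D, Frag G T B D → ∃ x ∈ D, x ∈ G.neighborSet o) (hclaw : NoClawAt G T o)
    (hnb : ∀ b, ∃ a ∈ T, a ∈ G.neighborSet o ∧ a ≠ b) :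
    ∃ a b, a ≠ b ∧ Chain G T {a} {b} := by
  obtain ⟨b₀, hb₀⟩ := hT.1
  by_cases hpair : ∀ M M', MinFrag G T {b₀} M → MinFrag G T {b₀} M' → M = M'
  · obtain ⟨a, -, -, hab, h⟩ := exists_chain_singleton (B := {b₀}) hT ⟨b₀, hb₀, rfl⟩
      (hmeet {b₀}) hpair (z := b₀) rfl (hnb b₀)
    exact ⟨a, b₀, hab, h⟩
  push Not at hpair
  obtain ⟨M₁, M₂, hM₁, hM₂, hne⟩ := hpair
  have hB₀ : ∃ x ∈ T, x ∈ ({b₀} : Set V) := ⟨b₀, hb₀, rfl⟩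
  have hdis : ¬ (M₁ ∩ M₂).Nonempty := fun h => hne
    ((hM₁.subset hT hB₀ hM₂.1 h).antisymm
      (hM₂.subset hT hB₀ hM₁.1 (by rwa [Finset.inter_comm])))
  obtain ⟨b, hbM, hbo⟩ := hmeet _ _ hM₁.1
  have hb : b ∈ T := hM₁.1.1 hbM
  have hB : ∃ x ∈ T, x ∈ ({b} : Set V) := ⟨b, hb, rfl⟩
  obtain ⟨c₁, hc₁⟩ := hM₁.1.2.2.2
  have hM₂b : Frag G T {b} M₂ := by
    refine ⟨hM₂.1.1, hM₂.1.2.1, ?_, hM₂.1.2.2.2⟩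
    rintro x hx rfl
    exact hdis ⟨x, by grind⟩
  -- With b moved to a neighbour of o inside M₁, every minimal fragment avoids b and its neighbours.
  -- Two such fragments would therefore give a claw at o with b as a leaf.
  have hfar : ∀ N, MinFrag G T {b} N → b ∉ N ∧ ∀ y ∈ N, ¬ G.Adj b y := by
    intro N hN
    obtain ⟨c, hc⟩ := hN.1.2.2.2
    have hbN : b ∉ N := fun h => hN.1.2.2.1 b h rfl
    have hmut : ¬ (c₁ ∈ N ∧ c ∈ M₁) := by
      rintro ⟨h1, h2⟩
      have heq := hT.2 (M₁ ∪ N) (Finset.union_subset hM₁.1.1 hN.1.1)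
        (hM₁.1.2.1.mono Finset.subset_union_left) (by
          intro x hx y hy hxy
          have := hc₁.2.2 x
          have := hc.2.2 x
          grind)
      have hsub : M₂ ⊆ N := by
        intro x hx
        have h3 := hM₂.1.1 hx
        rw [← heq] at h3
        rcases Finset.mem_union.1 h3 with h | h
        · exact (hdis ⟨x, by grind⟩).elim
        · exact h
      have := hN.2 _ hM₂b hsub
      subst this
      exact not_mutually_sealed hT hB₀ hM₁.1 hM₂.1 hc₁ hc ⟨h1, h2⟩
    have hdisj : ∀ x ∈ M₁, x ∉ N := by
      intro x hx hxN
      have := hM₁.2 (M₁ ∩ N) ⟨Finset.inter_subset_left.trans hM₁.1.1, ⟨x, by grind⟩,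
        fun y hy => hM₁.1.2.2.1 y (by grind), hc₁.inter hc hmut⟩ Finset.inter_subset_left
      rw [← this] at hbM
      grind
    refine ⟨hbN, fun y hy hby => hmut ?_⟩
    have h1 := hc₁.2.2 b hbM y (hN.1.1 hy) hby
    have h2 := hc.2.2 y hy b hb hby.symm
    grind
  obtain ⟨a, -, -, hab, h⟩ := exists_chain_singleton (B := {b}) hT hB (hmeet {b}) (by
    intro N N' hN hN'
    by_contra hNN
    have hd : ¬ (N ∩ N').Nonempty := fun h => hNN
      ((hN.subset hT hB hN'.1 h).antisymm
        (hN'.subset hT hB hN.1 (by rwa [Finset.inter_comm])))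
    obtain ⟨x, hx, hxo⟩ := hmeet _ _ hN.1
    obtain ⟨y, hy, hyo⟩ := hmeet _ _ hN'.1
    obtain ⟨h1, h2⟩ := hfar N hN
    obtain ⟨h3, h4⟩ := hfar N' hN'
    rcases hclaw b hb x (hN.1.1 hx) y (hN'.1.1 hy) hbo hxo hyo (by grind) (by grind)
      (by rintro rfl; exact hd ⟨x, by grind⟩) with h' | h' | h'
    · exact h2 x hx h'
    · exact h4 y hy h'
    · exact hN.1.not_adj hT hB hN'.1 hd hx hy h') (z := b) rfl (hnb b)
  exact ⟨a, b, hab, h⟩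

/-! ### From partitions to Λ-factors -/

theorem Fac.mono {H : SimpleGraph V} {S : Finset V} (h : Fac G S)
    (hGH : ∀ x ∈ S, ∀ y ∈ S, G.Adj x y → H.Adj x y) : Fac H S := by
  induction h with
  | empty => exact Fac.empty
  | add hS hx hy hz hxy hyz hxz ih =>
    exact Fac.add (ih fun x hx y hy => hGH x (by grind) y (by grind)) hx hy hz
      (hGH _ (by grind) _ (by grind) hxy) (hGH _ (by grind) _ (by grind) hyz) hxz

/-- The spanning subgraph given by a partition into three-vertex paths. -/
theorem Fac.exists_graph {S : Finset V} (h : Fac G S) :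
    ∃ P : SimpleGraph V, P ≤ G ∧ (∀ u v, P.Adj u v → u ∈ S) ∧
      ∀ v ∈ S, ∃ p q r : V, (v = p ∨ v = q ∨ v = r) ∧ P.Adj p q ∧ P.Adj q r ∧ p ≠ r ∧
        (∀ u, P.Adj p u → u = q) ∧ (∀ u, P.Adj q u → u = p ∨ u = r) ∧ (∀ u, P.Adj r u → u = q) := by
  induction h with
  | empty => exact ⟨⊥, bot_le, by simp, by simp⟩
  | @add S x y z hS hx hy hz hxy hyz hxz ih =>
    obtain ⟨P, hPG, hPS, hP⟩ := ih
    have hPS' : ∀ u v, P.Adj u v → v ∈ S := fun u v h => hPS v u h.symm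
    have h1 := hxy.ne
    have h2 := hyz.ne
    refine ⟨⟨fun u v => P.Adj u v ∨ (u = y ∧ (v = x ∨ v = z)) ∨ (v = y ∧ (u = x ∨ u = z)), ?_, ?_⟩,
      ?_, ?_, ?_⟩
    · refine ⟨fun u v h => ?_⟩
      rcases h with h | h | h
      · exact Or.inl h.symm
      · exact Or.inr (Or.inr h)
      · exact Or.inr (Or.inl h)
    · refine ⟨fun u h => ?_⟩
      rcases h with h | h | h
      · exact P.loopless.irrefl u h
      · grind
      · grind
    · intro u v h
      rcases h with h | ⟨rfl, rfl | rfl⟩ | ⟨rfl, rfl | rfl⟩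
      · exact hPG h
      · exact hxy.symm
      · exact hyz
      · exact hxy
      · exact hyz.symm
    · intro u v h
      rcases h with h | h | h
      · have := hPS u v h
        grind
      · grind
      · grind
    · intro v hv
      by_cases hvS : v ∈ S
      · obtain ⟨p, q, r, hv', hpq, hqr, hpr, h3, h4, h5⟩ := hP v hvS
        have := hPS p q hpq
        have := hPS q r hqr
        have := hPS' q r hqr
        refine ⟨p, q, r, hv', Or.inl hpq, Or.inl hqr, hpr, ?_, ?_, ?_⟩
        · rintro u (h | h | h)
          · exact h3 u h
          · grind
          · grind
        · rintro u (h | h | h)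
          · exact h4 u h
          · grind
          · grind
        · rintro u (h | h | h)
          · exact h5 u h
          · grind
          · grind
      · refine ⟨x, y, z, by grind, by simp, by simp, hxz, ?_, ?_, ?_⟩
        · rintro u (h | h | h)
          · exact (hx (hPS _ _ h)).elim
          · grind
          · grind
        · rintro u (h | h | h)
          · exact (hy (hPS _ _ h)).elim
          · grind
          · grind
        · rintro u (h | h | h)
          · exact (hz (hPS _ _ h)).elim
          · grind
          · grind

theorem Fac.hasLambdaFactor [Fintype V] (h : Fac G Finset.univ) : HasLambdaFactor G := by
  obtain ⟨P, hPG, -, hP⟩ := h.exists_graph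
  refine ⟨P, hPG, fun C => ?_⟩
  induction C using SimpleGraph.ConnectedComponent.ind with
  | h v =>
    obtain ⟨p, q, r, hv, hpq, hqr, hpr, h1, h2, h3⟩ := hP v (Finset.mem_univ v)
    have hcl : ∀ u w, P.Reachable u w → (u = p ∨ u = q ∨ u = r) → (w = p ∨ w = q ∨ w = r) := by
      rintro u w ⟨W⟩ hu
      induction W with
      | nil => exact hu
      | @cons a c d hac _ ih =>
        apply ih
        rcases hu with rfl | rfl | rfl
        · exact Or.inr (Or.inl (h1 _ hac))
        · rcases h2 _ hac with h | h <;> simp [h]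
        · exact Or.inr (Or.inl (h3 _ hac))
    have hqv : P.Reachable q v := by
      rcases hv with rfl | rfl | rfl
      · exact hpq.symm.reachable
      · exact SimpleGraph.Reachable.refl _
      · exact hqr.reachable
    have hsupp : ∀ w, w ∈ (P.connectedComponentMk v).supp ↔ (w = p ∨ w = q ∨ w = r) := by
      intro w
      rw [SimpleGraph.ConnectedComponent.mem_supp_iff, SimpleGraph.ConnectedComponent.eq]
      refine ⟨fun h => hcl v w h.symm hv, ?_⟩
      rintro (rfl | rfl | rfl)
      · exact hpq.reachable.trans hqv
      · exact hqv
      · exact hqr.symm.reachable.trans hqv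
    have hpq' := hpq.ne
    have hqr' := hqr.ne
    have hmem : ∀ i : Fin 3, ![p, q, r] i ∈ (P.connectedComponentMk v).supp := by
      intro i
      rw [hsupp]
      fin_cases i <;> simp
    let f : Fin 3 → (P.connectedComponentMk v) := fun i => ⟨![p, q, r] i, hmem i⟩
    have hf : Function.Bijective f := by
      constructor
      · intro i j hij
        have : ![p, q, r] i = ![p, q, r] j := congrArg Subtype.val hij
        fin_cases i <;> fin_cases j <;> simp_all
      · rintro ⟨w, hw⟩
        rcases (hsupp w).1 hw with rfl | rfl | rfl
        · exact ⟨0, rfl⟩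
        · exact ⟨1, rfl⟩
        · exact ⟨2, rfl⟩
    have hnpr : ¬ P.Adj p r := fun h => hqr' (h1 _ h).symm
    have hnrp : ¬ P.Adj r p := fun h => hnpr h.symm
    have hadj : ∀ i j : Fin 3, P.Adj (![p, q, r] i) (![p, q, r] j) ↔
        (SimpleGraph.pathGraph 3).Adj i j := by
      intro i j
      rw [SimpleGraph.pathGraph_adj]
      fin_cases i <;> fin_cases j <;>
        simp [hpq, hqr, hpq.symm, hqr.symm, hnpr, hnrp]
    exact ⟨(⟨Equiv.ofBijective f hf, fun {i j} => hadj i j⟩ :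
      SimpleGraph.pathGraph 3 ≃g (P.connectedComponentMk v).toSimpleGraph).symm⟩

theorem Fac.deleteVertex {x : V} {S : Finset V} (h : Fac G S) (hx : x ∉ S) :
    Fac (deleteVertex G x) (S.subtype fun v => v ∈ {v : V | v ≠ x}) := by
  induction h with
  | empty =>
    have : ((∅ : Finset V).subtype fun v => v ∈ {v : V | v ≠ x}) = ∅ := by ext; simp
    rw [this]
    exact Fac.empty
  | @add S p q r hS hp hq hr hpq hqr hpr ih =>
    have hpx : p ≠ x := by grind
    have hqx : q ≠ x := by grind
    have hrx : r ≠ x := by grind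
    have := Fac.add (ih (by grind)) (x := ⟨p, hpx⟩) (y := ⟨q, hqx⟩) (z := ⟨r, hrx⟩)
      (by simpa using hp) (by simpa using hq) (by simpa using hr)
      (SimpleGraph.induce_adj.2 hpq) (SimpleGraph.induce_adj.2 hqr)
      (by simpa using hpr)
    convert this using 1
    ext ⟨v, hv⟩
    simp

theorem hasLambdaFactor_deleteVertex [Fintype V] {x : V} (h : Fac G (Finset.univ.erase x)) :
    HasLambdaFactor (deleteVertex G x) := by
  have h' := h.deleteVertex (x := x) (by simp)
  have : ((Finset.univ.erase x).subtype fun v => v ∈ {v : V | v ≠ x}) = Finset.univ := by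
    ext ⟨v, hv⟩
    simpa using hv
  rw [this] at h'
  convert h'.hasLambdaFactor

/-! ### Using claw-freeness and connectivity of the graph -/

theorem noClawAt_of_clawFree (h : ClawFree G) (S : Finset V) (w : V) : NoClawAt G S w := by
  intro x _ y _ z _ hx hy hz hxy hxz hyz
  by_contra hcon
  push Not at hcon
  obtain ⟨h1, h2, h3⟩ := hcon
  have hwx := hx.ne
  have hwy := hy.ne
  have hwz := hz.ne
  refine h ⟨⟨⟨Sum.elim (fun _ => w) ![x, y, z], ?_⟩, ?_⟩⟩
  · rintro (i | i) (j | j) hij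
    · rw [Subsingleton.elim i j]
    · fin_cases j <;> simp_all
    · fin_cases i <;> simp_all
    · fin_cases i <;> fin_cases j <;> simp_all
  · intro i j
    change G.Adj (Sum.elim (fun _ => w) ![x, y, z] i) (Sum.elim (fun _ => w) ![x, y, z] j) ↔ _
    have h1' : ¬ G.Adj y x := fun h => h1 h.symm
    have h2' : ¬ G.Adj z x := fun h => h2 h.symm
    have h3' : ¬ G.Adj z y := fun h => h3 h.symm
    rcases i with i | i <;> rcases j with j | j
    · simp
    · fin_cases j <;> simp [hx, hy, hz]
    · fin_cases i <;> simp [hx.symm, hy.symm, hz.symm]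
    · fin_cases i <;> fin_cases j <;> simp [h1, h2, h3, h1', h2', h3']

/-- In a connected induced subgraph a nonempty closed set is everything. -/
theorem mem_of_connected {S : Finset V} (h : (G.induce {v : V | v ∉ S}).Connected) {D : Finset V}
    (hne : ∃ x ∈ D, x ∉ S) (hcl : ∀ x ∈ D, x ∉ S → ∀ y, y ∉ S → G.Adj x y → y ∈ D) {y : V}
    (hy : y ∉ S) : y ∈ D := by
  obtain ⟨x, hxD, hxS⟩ := hne
  have key : ∀ u v : {v : V | v ∉ S}, (G.induce {v : V | v ∉ S}).Walk u v → u.1 ∈ D → v.1 ∈ D := by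
    intro u v W
    induction W with
    | nil => exact id
    | @cons a c d hac _ ih => exact fun ha => ih (hcl _ ha a.2 _ c.2 hac)
  obtain ⟨W⟩ := h.preconnected ⟨x, hxS⟩ ⟨y, hy⟩
  exact key _ _ W hxD

section Main

variable [Fintype V]

theorem conn_erase (h : IsVertexKConnected G 2) (x : V) : Conn G (Finset.univ.erase x) := by
  have hcard := Finset.card_erase_add_one (Finset.mem_univ x)
  have h1 := h.1
  rw [Finset.card_univ] at hcard
  refine ⟨Finset.card_pos.1 (by omega), fun D hD hne hcl => hD.antisymm fun y hy => ?_⟩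
  obtain ⟨z, hz⟩ := hne
  refine mem_of_connected (h.2 {x} (by simp)) ⟨z, hz, ?_⟩ (fun u hu _ v hv huv => ?_) (by grind)
  · have := hD hz
    grind
  · exact hcl u hu v (by grind) huv

/-- Otherwise the sealing vertex alone would separate D from x in G. -/
theorem frag_adj (h : IsVertexKConnected G 2) (x : V) {B : Set V} {D : Finset V}
    (hD : Frag G (Finset.univ.erase x) B D) : ∃ y ∈ D, y ∈ G.neighborSet x := by
  obtain ⟨hDS, ⟨z, hz⟩, -, c, hc, hcD, hcl⟩ := hD
  by_contra hcon
  push Not at hcon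
  have hxD : x ∈ D := mem_of_connected (h.2 {c} (by simp)) ⟨z, hz, by grind⟩
    (fun u hu _ v hv huv => by
      have h1 : v ≠ x := by rintro rfl; exact hcon u hu huv.symm
      have := hcl u hu v (by grind) huv
      grind) (by grind)
  have := hDS hxD
  grind

theorem fac_erase (hclaw : ClawFree G) (hcard : Fintype.card V ≡ 1 [MOD 3])
    (h : IsVertexKConnected G 2) (x : V) : Fac G (Finset.univ.erase x) := by
  have hc := Finset.card_erase_add_one (Finset.mem_univ x)
  rw [Finset.card_univ] at hc
  have h1 := h.1
  have hmod : Fintype.card V % 3 = 1 := hcard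
  obtain ⟨a, b, hab, hch⟩ := exists_chain_ends (o := x) (conn_erase h x)
    (fun B D hD => frag_adj h x hD) (noClawAt_of_clawFree hclaw _ _) (by
      intro b
      by_contra hcon
      push Not at hcon
      -- If b were the only possible neighbour of x, deleting b would isolate x.
      have hall : ∀ y, y ≠ b → x ≠ b → y = x := fun y hy hxb => by
        have : y ∈ ({x} : Finset V) := mem_of_connected (h.2 {b} (by simp)) ⟨x, by simp, by simpa⟩
          (fun u hu _ v hv huv => by
            rw [Finset.mem_singleton] at hu hv ⊢
            subst hu
            exact (hv (hcon v (by simpa using huv.ne.symm) huv)).elim) (by simpa)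
        simpa using this
      by_cases hxb : x = b
      · subst hxb
        obtain ⟨y, hy⟩ := (conn_erase h x).1
        have := mem_of_connected (D := {x}) (h.2 ∅ (by simp)) ⟨x, by simp, by simp⟩
          (fun u hu _ v hv huv => by
            rw [Finset.mem_singleton] at hu
            subst hu
            exact (huv.ne (hcon v (by simpa using huv.ne.symm) huv).symm).elim)
          (Finset.notMem_empty y)
        grind
      · have hsub : (Finset.univ : Finset V) ⊆ {x, b} := fun y _ => by
          by_cases hy : y = b
          · simp [hy]
          · simp [hall y hy hxb]
        have := (Finset.card_le_card hsub).trans Finset.card_le_two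
        rw [Finset.card_univ] at this
        omega)
  exact hch.fac (by omega) hab
    (CF.endClaws (fun w _ => noClawAt_of_clawFree hclaw _ w) a b)

theorem fac_erase_deleteEdges (hclaw : ClawFree G) (hcard : Fintype.card V ≡ 1 [MOD 3])
    (h : IsVertexKConnected G 3) (x : V) {u v : V} (huv : u ≠ v) (hux : u ≠ x) (hvx : v ≠ x) :
    Fac (G.deleteEdges {s(u, v)}) (Finset.univ.erase x) := by
  have hc := Finset.card_erase_add_one (Finset.mem_univ x)
  rw [Finset.card_univ] at hc
  have h1 := h.1
  have hmod : Fintype.card V % 3 = 1 := hcard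
  have hadj : ∀ p q, (G.deleteEdges {s(u, v)}).Adj p q ↔
      G.Adj p q ∧ ¬ ((p = u ∧ q = v) ∨ (p = v ∧ q = u)) := by
    intro p q
    simp [SimpleGraph.deleteEdges_adj]
  have hclosed : ∀ (c : V) (D : Finset V), (∀ y ∈ D, y ≠ x ∧ y ≠ c) → D.Nonempty →
      (∀ p ∈ D, ∀ q, q ≠ x → q ≠ c → G.Adj p q → q ∈ D) → ∀ y, y ≠ x → y ≠ c → y ∈ D := by
    rintro c D hD ⟨z, hz⟩ hcl y hyx hyc
    refine mem_of_connected (S := {x, c}) (h.2 _ (Finset.card_le_two.trans_lt (by omega)))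
      ⟨z, hz, by have := hD z hz; grind⟩ (fun p hp _ q hq hpq => hcl p hp q (by grind) (by grind) hpq)
      (by grind)
  have hchain : Chain (G.deleteEdges {s(u, v)}) (Finset.univ.erase x) {u} {v} := by
    -- Only the edge st is missing. If D avoids t, then D without s has all its G-neighbours in D ∪
    -- {x, s}; were it nonempty, 3-connectedness would put t into it.
    have key : ∀ s t, ({s, t} : Set V) = {u, v} → t ≠ x → s ≠ t → ∀ D ⊆ Finset.univ.erase x,
        D.Nonempty → t ∉ D → (∀ p ∈ D, ∀ q ∈ Finset.univ.erase x,
          (G.deleteEdges {s(u, v)}).Adj p q → q ∈ D) → D = {s} := by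
      intro s t hst htx hsne D hD hne htD hcl
      have hst' : (u = s ∧ v = t) ∨ (u = t ∧ v = s) := by
        rcases Set.pair_eq_pair_iff.1 hst with h | h <;> grind
      by_contra hDs
      refine htD (Finset.mem_of_mem_erase (a := s) (hclosed s (D.erase s) ?_ ?_ ?_ t htx hsne.symm))
      · intro y hy
        have := @hD y
        grind
      · by_contra hcon
        rw [Finset.not_nonempty_iff_eq_empty, Finset.erase_eq_empty_iff] at hcon
        rcases hcon with h' | h'
        · exact hne.ne_empty h'
        · exact hDs h'
      · intro p hp q hqx hqu hpq
        have := hcl p (by grind) q (by grind) ((hadj p q).2 ⟨hpq, by grind⟩)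
        grind
    have key₁ := key u v rfl hvx huv
    have key₂ := key v u (Set.pair_comm _ _) hux huv.symm
    refine ⟨⟨⟨u, by grind⟩, fun D hD hne hcl => ?_⟩, ⟨u, by grind, rfl⟩, ⟨v, by grind, rfl⟩, ?_⟩
    -- A disconnection would have {u} and {v} as its two sides, so G would have only three vertices.
    · by_contra hneq
      have hE : (Finset.univ.erase x \ D).Nonempty := by
        rw [Finset.sdiff_nonempty]
        exact fun h' => hneq (hD.antisymm h')
      have hclE : ∀ p ∈ Finset.univ.erase x \ D, ∀ q ∈ Finset.univ.erase x,
          (G.deleteEdges {s(u, v)}).Adj p q → q ∈ Finset.univ.erase x \ D := by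
        intro p hp q hq hpq
        have := hcl q
        have := hpq.symm
        grind
      have hsum := Finset.card_sdiff_add_card_eq_card hD
      by_cases hvD : v ∈ D
      · have h2 := key₁ _ Finset.sdiff_subset hE (by grind) hclE
        have huD : u ∉ D := by
          have : u ∈ Finset.univ.erase x \ D := by rw [h2]; simp
          grind
        have h3 := key₂ D hD hne huD hcl
        rw [h2, h3, Finset.card_singleton, Finset.card_singleton] at hsum
        omega
      · have h2 := key₁ D hD hne hvD hcl
        have h3 := key₂ _ Finset.sdiff_subset hE (by grind) hclE
        rw [h3, h2, Finset.card_singleton, Finset.card_singleton] at hsum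
        omega
    · rintro D ⟨hD, hne, hDv, c, hc, hcD, hcl⟩
      by_contra hcon
      have huD : u ∉ D := fun h => hcon ⟨u, h, rfl⟩
      have hvD : v ∉ D := fun h => hDv v h rfl
      -- A part avoiding u and v does not notice the deleted edge, so {x, c} seals it in G; hence it
      -- contains every vertex except x and c, and therefore u or v.
      have hall := hclosed c D (fun y hy => by have := @hD y; grind) hne
        (fun p hp q hqx hqc hpq => by
          have := hcl p hp q (by grind) ((hadj p q).2 ⟨hpq, by grind⟩)
          grind)
      have := hall u hux
      have := hall v hvx
      grind
  refine hchain.fac (by omega) huv ?_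
  intro w _ X _ hcl
  simp only [NoClawAt] at hcl
  push Not at hcl
  obtain ⟨p, hp, q, hq, r, hr, hwp, hwq, hwr, hpq, hpr, hqr, n1, n2, n3⟩ := hcl
  rw [hadj] at hwp hwq hwr n1 n2 n3
  -- The leaves are not independent in G, so the only missing edge joins two of them: u and v are
  -- leaves.
  rcases noClawAt_of_clawFree hclaw X w p hp q hq r hr hwp.1 hwq.1 hwr.1 hpq hpr hqr
    with h' | h' | h' <;> grind

end Main

end LambdaFactor

theorem mainTheorem5 {V : Type*} [Fintype V] (G : SimpleGraph V)
    (hclaw : ClawFree G) (hcard : Fintype.card V ≡ 1 [MOD 3]) :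
    (IsVertexKConnected G 2 → ∀ x : V, HasLambdaFactor (deleteVertex G x)) ∧
    (IsVertexKConnected G 3 → ∀ x : V, ∀ e ∈ G.edgeSet,
      HasLambdaFactor (deleteVertex (G.deleteEdges {e}) x)) := by
  classical
  refine ⟨fun h x => LambdaFactor.hasLambdaFactor_deleteVertex
    (LambdaFactor.fac_erase hclaw hcard h x), fun h x e he => ?_⟩
  apply LambdaFactor.hasLambdaFactor_deleteVertex
  induction e using Sym2.ind with
  | _ u v =>
    have huv : u ≠ v := G.ne_of_adj he
    by_cases hx : u = x ∨ v = x
    · have h2 : IsVertexKConnected G 2 :=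
        ⟨(Nat.lt_succ_self 2).trans h.1, fun S hS => h.2 S (hS.trans (Nat.lt_succ_self 2))⟩
      -- The edge e disappears with x anyway, so paths avoiding x do not use it.
      refine (LambdaFactor.fac_erase hclaw hcard h2 x).mono fun p hp q hq hpq => ?_
      rw [SimpleGraph.deleteEdges_adj]
      refine ⟨hpq, ?_⟩
      simp only [Set.mem_singleton_iff, Sym2.eq_iff]
      grind
    · push Not at hx
      exact LambdaFactor.fac_erase_deleteEdges hclaw hcard h x huv hx.1 hx.2
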